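/- Let $\ell,T>0$. Let $\rho,\mu\in L^\infty(0,\ell)$ and $r,\kappa\in H^2(0,\ell)$ satisfy, almost everywhere on $(0,\ell)$, $0<\rho_0\le\rho\le\rho_1$, $0\le\mu_0\le\mu\le\mu_1$, $0<r_0\le r\le r_1$, $0<\kappa_0\le\kappa\le\kappa_1$ for some constants. Let $\mathcal V=\{v\in H^2(0,\ell): v(0)=v_x(0)=0\}$ with the $H^2(0,\ell)$ norm. For $g\in H^1(0,T)$ with $g(0)=0$, a weak solution of the damped beam problem $$\rho u_{tt}+\mu u_t+(r u_{xx})_{xx}+(\kappa u_{xxt})_{xx}=0\ \text{ in }(0,\ell)\times(0,T],\qquad u(x,0)=u_t(x,0)=0,$$ $$u(0,t)=u_x(0,t)=0,\quad [r u_{xx}+\kappa u_{xxt}]_{x=\ell}=0,\quad -[(r u_{xx}+\kappa u_{xxt})_x]_{x=\ell}=g(t)$$ is a function $u\in L^2(0,T;\mathcal V)$ with $u_t\in L^2(0,T;\mathcal V)$, $u_{tt}\in L^2(0,T;L^2(0,\ell))$, $u(0)=0$, $u_t(0)=0$ and, for a.e. $t\in(0,T)$ and all $v\in\mathcal V$,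 $$(\rho u_{tt}(t),v)+(\mu u_t(t),v)+(r u_{xx}(t),v_{xx})+(\kappa u_{xxt}(t),v_{xx})=g(t)v(\ell),$$ where $(\cdot,\cdot)$ is the inner product of $L^2(0,\ell)$. For each such $g$ there is a unique weak solution $u(\cdot,\cdot;g)$. Let $C_g,\tilde C_g>0$ and put $$\mathcal G_1=\{g\in H^1(0,T): g(0)=0,\ \|g\|_{H^1(0,T)}\le C_g\},$$ $$\mathcal G_3=\{g\in H^3(0,T): g(0)=g'(0)=g''(0)=0,\ \|g\|_{H^3(0,T)}\le\tilde C_g\}.$$ The operators $\Phi:\mathcal G_1\to L^2(0,T)$, $(\Phi g)(t)=u(\ell,t;g)$, and $\Psi:\mathcal G_3\to L^2(0,T)$, $(\Psi g)(t)=-\big(r(0)u_{xx}(0,t;g)+\kappa(0)u_{xxt}(0,t;g)\big)$, are well defined. (Values at a point are those of the continuous representatives.) Moreover, for all $\nu,\omega\in L^2(0,T)$ and $\alpha>0$, the regularized Tikhonov functional $$\mathcal J_{1\alpha}(g)=\tfrac12\|\Phi g-\nu\|^2_{L^2(0,T)}+\tfrac\alpha2\|g'\|^2_{L^2(0,T)}$$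 has a unique minimizer on $\mathcal G_1$, and $$\mathcal J_{2\alpha}(g)=\tfrac12\|\Psi g-\omega\|^2_{L^2(0,T)}+\tfrac\alpha2\|g'''\|^2_{L^2(0,T)}$$ has a unique minimizer on $\mathcal G_3$. -/

import Mathlib

open MeasureTheory Set

namespace KelvinVoigtBeam

noncomputable section

/-- Lebesgue measure on the open interval `(a, b)`. -/
abbrev vol (a b : ℝ) : Measure ℝ := volume.restrict (Ioo a b)

/-- The space `L²(a, b)`. -/
abbrev L2 (a b : ℝ) : Type := Lp ℝ 2 (vol a b)

/-- `f'` is the weak (distributional) derivative of `f` on `(a, b)`. The functions may take values in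
a Banach space, in which case the integrals are Bochner integrals. -/
def IsWeakDeriv {E : Type*} [NormedAddCommGroup E] [NormedSpace ℝ E]
    (a b : ℝ) (f f' : ℝ → E) : Prop :=
  ∀ φ : ℝ → ℝ, ContDiff ℝ ((⊤ : ℕ∞) : WithTop ℕ∞) φ → HasCompactSupport φ → tsupport φ ⊆ Ioo a b →
    ∫ x, deriv φ x • f x ∂(vol a b) = -∫ x, φ x • f' x ∂(vol a b)

/-- The function `f`, given up to null sets on `(a, b)`, has a representative that is continuous on
`[a, b]` and takes the value `y` at the point `c`. -/
def HasValueAt {E : Type*} [TopologicalSpace E] (a b : ℝ) (f : ℝ → E) (c : ℝ) (y : E) : Prop :=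
  ∃ F : ℝ → E, ContinuousOn F (Icc a b) ∧ F =ᵐ[vol a b] f ∧ F c = y

open Classical in
/-- The value at `c` of the continuous representative of `f` on `[a, b]` (and `0` if there is no such
representative). -/
def valueAt (a b : ℝ) (f : ℝ → ℝ) (c : ℝ) : ℝ :=
  if h : ∃ y, HasValueAt a b f c y then h.choose else 0

theorem HasValueAt.unique {E : Type*} [TopologicalSpace E] [T2Space E] {a b c : ℝ} (hab : a < b)
    (hc : c ∈ Icc a b) {f : ℝ → E} {y z : E} (hy : HasValueAt a b f c y)
    (hz : HasValueAt a b f c z) : y = z := by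
  obtain ⟨F, hF, hFf, rfl⟩ := hy
  obtain ⟨G, hG, hGf, rfl⟩ := hz
  have hIoo : EqOn F G (Ioo a b) :=
    Measure.eqOn_open_of_ae_eq (hFf.trans hGf.symm) isOpen_Ioo
      (hF.mono Ioo_subset_Icc_self) (hG.mono Ioo_subset_Icc_self)
  have hIcc : EqOn F G (Icc a b) :=
    hIoo.of_subset_closure hF hG Ioo_subset_Icc_self (closure_Ioo hab.ne).ge
  exact hIcc hc

theorem HasValueAt.valueAt_eq {a b c : ℝ} (hab : a < b) (hc : c ∈ Icc a b) {f : ℝ → ℝ} {y : ℝ}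
    (hy : HasValueAt a b f c y) : valueAt a b f c = y := by
  have h : ∃ y, HasValueAt a b f c y := ⟨y, hy⟩
  rw [valueAt, dif_pos h]
  exact h.choose_spec.unique hab hc hy

/-- Tuples `(f₀, …, f_m)` of elements of `L²(a, b)` with the Euclidean norm
`(‖f₀‖² + ⋯ + ‖f_m‖²) ^ (1/2)`. -/
abbrev Jet (a b : ℝ) (m : ℕ) : Type := PiLp 2 (fun _ : Fin (m + 1) => L2 a b)

theorem integrable_test_smul {a b : ℝ} {ψ : ℝ → ℝ} (hψ : Continuous ψ)
    (hc : HasCompactSupport ψ) (f : L2 a b) : Integrable (fun x => ψ x • f x) (vol a b) := by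
  have hf : Integrable f (vol a b) := (Lp.memLp f).integrable (by norm_num)
  obtain ⟨C, hC⟩ := hc.exists_bound_of_continuous hψ
  exact hf.bdd_smul C hψ.aestronglyMeasurable (Filter.Eventually.of_forall hC)

/-- The Sobolev space `H^m(a, b)`: an element is stored as the tuple `(f, f', …, f^(m))` of a function
`f ∈ L²(a, b)` and its weak derivatives, all in `L²(a, b)`. The norm is
`‖f‖² = ∑_{i ≤ m} ‖f^(i)‖²_{L²}`. -/
def Sobolev (a b : ℝ) (m : ℕ) : Submodule ℝ (Jet a b m) where
  carrier := {F | ∀ i : Fin m, IsWeakDeriv a b (F i.castSucc) (F i.succ)}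
  zero_mem' := by
    intro i φ _ _ _
    have h : ∀ ψ : ℝ → ℝ, ∫ x, ψ x • ((0 : L2 a b) : ℝ → ℝ) x ∂(vol a b) = 0 := by
      intro ψ
      apply integral_eq_zero_of_ae
      filter_upwards [Lp.coeFn_zero ℝ 2 (vol a b)] with x hx
      rw [hx]
      simp
    simpa using (h (deriv φ)).trans (neg_eq_zero.mpr (h φ)).symm
  add_mem' := by
    intro F G hF hG i φ hφ hc hs
    have h : ∀ (ψ : ℝ → ℝ), Continuous ψ → HasCompactSupport ψ → ∀ p q : L2 a b,
        ∫ x, ψ x • (p + q : L2 a b) x ∂(vol a b)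
          = ∫ x, ψ x • p x ∂(vol a b) + ∫ x, ψ x • q x ∂(vol a b) := by
      intro ψ hψ hψc p q
      rw [← integral_add (integrable_test_smul hψ hψc p) (integrable_test_smul hψ hψc q)]
      apply integral_congr_ae
      filter_upwards [Lp.coeFn_add p q] with x hx
      rw [hx, Pi.add_apply, smul_add]
    have h1 := h (deriv φ) (hφ.continuous_deriv (by simp)) hc.deriv (F i.castSucc) (G i.castSucc)
    have h2 := h φ hφ.continuous hc (F i.succ) (G i.succ)
    have h3 := hF i φ hφ hc hs
    have h4 := hG i φ hφ hc hs
    simp only [PiLp.add_apply]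
    rw [h1, h2, h3, h4, neg_add]
  smul_mem' := by
    intro c F hF i φ hφ hc hs
    have h : ∀ (ψ : ℝ → ℝ) (p : L2 a b),
        ∫ x, ψ x • (c • p : L2 a b) x ∂(vol a b) = c * ∫ x, ψ x • p x ∂(vol a b) := by
      intro ψ p
      rw [← integral_const_mul]
      apply integral_congr_ae
      filter_upwards [Lp.coeFn_smul c p] with x hx
      simp only [hx, Pi.smul_apply, smul_eq_mul]
      ring
    simp only [PiLp.smul_apply]
    rw [h, h, hF i φ hφ hc hs, mul_neg]

/-- The `i`-th weak derivative of `f ∈ H^m(a, b)`, an element of `L²(a, b)`. -/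
def Sobolev.D {a b : ℝ} {m : ℕ} (i : Fin (m + 1)) (f : Sobolev a b m) : L2 a b :=
  (f : Jet a b m) i

/-- The space `{v ∈ H²(0, ℓ) : v(0) = v_x(0) = 0}` with the norm of `H²(0, ℓ)`. -/
def V (ℓ : ℝ) : Submodule ℝ (Jet 0 ℓ 2) where
  carrier := {v | v ∈ Sobolev 0 ℓ 2 ∧ HasValueAt 0 ℓ (v 0) 0 0 ∧ HasValueAt 0 ℓ (v 1) 0 0}
  zero_mem' := by
    refine ⟨zero_mem _, ?_, ?_⟩ <;>
    exact ⟨0, continuousOn_const, (Lp.coeFn_zero ℝ 2 (vol 0 ℓ)).symm, rfl⟩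
  add_mem' := by
    have h : ∀ p q : L2 0 ℓ, HasValueAt 0 ℓ p 0 0 → HasValueAt 0 ℓ q 0 0 →
        HasValueAt 0 ℓ (p + q : L2 0 ℓ) 0 0 := by
      rintro p q ⟨P, hP, hPp, hP0⟩ ⟨Q, hQ, hQq, hQ0⟩
      exact ⟨P + Q, hP.add hQ, (hPp.add hQq).trans (Lp.coeFn_add p q).symm, by simp [hP0, hQ0]⟩
    intro v w hv hw
    exact ⟨add_mem hv.1 hw.1, h _ _ hv.2.1 hw.2.1, h _ _ hv.2.2 hw.2.2⟩
  smul_mem' := by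
    have h : ∀ (c : ℝ) (p : L2 0 ℓ), HasValueAt 0 ℓ p 0 0 →
        HasValueAt 0 ℓ (c • p : L2 0 ℓ) 0 0 := by
      rintro c p ⟨P, hP, hPp, hP0⟩
      exact ⟨c • P, hP.const_smul c, (hPp.const_smul c).trans (Lp.coeFn_smul c p).symm,
        by simp [hP0]⟩
    intro c v hv
    exact ⟨Submodule.smul_mem _ c hv.1, h c _ hv.2.1, h c _ hv.2.2⟩

/-- The `i`-th weak derivative in space, `v ↦ ∂ₓⁱ v`, of an element of `V ℓ`. -/
def V.D {ℓ : ℝ} (i : Fin 3) (v : V ℓ) : L2 0 ℓ := (v : Jet 0 ℓ 2) i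

/-- The Bochner space `L²(0, T; E)`. -/
abbrev L2Time (T : ℝ) (E : Type) [NormedAddCommGroup E] : Type := Lp E 2 (vol 0 T)

/-- `u` is a weak solution, with time derivatives `ut = u_t` and `utt = u_tt`, of
`ρ u_tt + μ u_t + (r u_xx)_xx + (κ u_xxt)_xx = 0` on `(0, ℓ) × (0, T]` with
`u(x, 0) = u_t(x, 0) = 0`, `u(0, t) = u_x(0, t) = 0`, `[r u_xx + κ u_xxt]_{x = ℓ} = 0` and
`-[(r u_xx + κ u_xxt)_x]_{x = ℓ} = g(t)`. -/
structure IsWeakSolution {ℓ T : ℝ} (ρ μ : Lp ℝ ⊤ (vol 0 ℓ)) (r κ : Sobolev 0 ℓ 2) (g : L2 0 T)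
    (u ut : L2Time T (V ℓ)) (utt : L2Time T (L2 0 ℓ)) : Prop where
  /-- `ut` is the weak time derivative of `u`, as `H²(0, ℓ)`-valued functions. -/
  weakDeriv_u : IsWeakDeriv 0 T (fun t => (u t : Jet 0 ℓ 2))
    (fun t => (ut t : Jet 0 ℓ 2))
  /-- `utt` is the weak time derivative of `ut`, as `L²(0, ℓ)`-valued functions. -/
  weakDeriv_ut : IsWeakDeriv 0 T (fun t => V.D 0 (ut t)) utt
  /-- The variational equation. -/
  equation : ∀ᵐ t ∂(vol 0 T), ∀ v : V ℓ,
    (∫ x, ρ x * utt t x * V.D 0 v x ∂(vol 0 ℓ))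
      + (∫ x, μ x * V.D 0 (ut t) x * V.D 0 v x ∂(vol 0 ℓ))
      + (∫ x, Sobolev.D 0 r x * V.D 2 (u t) x * V.D 2 v x ∂(vol 0 ℓ))
      + (∫ x, Sobolev.D 0 κ x * V.D 2 (ut t) x * V.D 2 v x ∂(vol 0 ℓ))
      = g t * valueAt 0 ℓ (V.D 0 v) ℓ
  /-- `u(0) = 0`, for the representative of `u` in `C([0, T]; V)`. -/
  init_u : HasValueAt 0 T u 0 0
  /-- `u_t(0) = 0`, for the representative of `u_t` in `C([0, T]; L²(0, ℓ))`. -/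
  init_ut : HasValueAt 0 T (fun t => V.D 0 (ut t)) 0 0

/-- `y ∈ L²(0, T)` is the deflection `t ↦ u(ℓ, t; g)` at the right end. -/
def IsDeflection {ℓ T : ℝ} (ρ μ : Lp ℝ ⊤ (vol 0 ℓ)) (r κ : Sobolev 0 ℓ 2) (g y : L2 0 T) : Prop :=
  ∃ (u ut : L2Time T (V ℓ)) (utt : L2Time T (L2 0 ℓ)), IsWeakSolution ρ μ r κ g u ut utt ∧
    ∀ᵐ t ∂(vol 0 T), HasValueAt 0 ℓ (V.D 0 (u t)) ℓ (y t)

/-- `y ∈ L²(0, T)` is the bending moment `t ↦ -(r(0) u_xx(0, t; g) + κ(0) u_xxt(0, t; g))` at the left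
end; for almost every `t` the functions `u_xx(·, t)` and `u_xxt(·, t)` are required to have continuous
representatives, whose values `p` and `q` at `x = 0` are taken. -/
def IsMoment {ℓ T : ℝ} (ρ μ : Lp ℝ ⊤ (vol 0 ℓ)) (r κ : Sobolev 0 ℓ 2) (g y : L2 0 T) : Prop :=
  ∃ (u ut : L2Time T (V ℓ)) (utt : L2Time T (L2 0 ℓ)), IsWeakSolution ρ μ r κ g u ut utt ∧
    ∀ᵐ t ∂(vol 0 T), ∃ p q : ℝ,
      HasValueAt 0 ℓ (V.D 2 (u t)) 0 p ∧ HasValueAt 0 ℓ (V.D 2 (ut t)) 0 q ∧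
      y t = -(valueAt 0 ℓ (Sobolev.D 0 r) 0 * p + valueAt 0 ℓ (Sobolev.D 0 κ) 0 * q)

open Classical in
/-- The Neumann-to-Dirichlet operator `(Φ g)(t) = u(ℓ, t; g)`. The default `0` is used only where the
deflection does not exist as an element of `L²(0, T)`. -/
def Phi {ℓ T : ℝ} (ρ μ : Lp ℝ ⊤ (vol 0 ℓ)) (r κ : Sobolev 0 ℓ 2) (g : L2 0 T) : L2 0 T :=
  if h : ∃ y, IsDeflection ρ μ r κ g y then h.choose else 0

open Classical in
/-- The Neumann-to-Neumann operator `(Ψ g)(t) = -(r(0) u_xx(0, t; g) + κ(0) u_xxt(0, t; g))`. The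
default `0` is used only where the moment does not exist as an element of `L²(0, T)`. -/
def Psi {ℓ T : ℝ} (ρ μ : Lp ℝ ⊤ (vol 0 ℓ)) (r κ : Sobolev 0 ℓ 2) (g : L2 0 T) : L2 0 T :=
  if h : ∃ y, IsMoment ρ μ r κ g y then h.choose else 0

/-- The admissible set `{g ∈ H¹(0, T) : g(0) = 0, ‖g‖_{H¹} ≤ C}`. -/
def G1 (T C : ℝ) : Set (Sobolev 0 T 1) :=
  {g | HasValueAt 0 T (Sobolev.D 0 g) 0 0 ∧ ‖g‖ ≤ C}

/-- The admissible set `{g ∈ H³(0, T) : g(0) = g'(0) = g''(0) = 0, ‖g‖_{H³} ≤ C}`. -/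
def G3 (T C : ℝ) : Set (Sobolev 0 T 3) :=
  {g | HasValueAt 0 T (Sobolev.D 0 g) 0 0 ∧ HasValueAt 0 T (Sobolev.D 1 g) 0 0 ∧
    HasValueAt 0 T (Sobolev.D 2 g) 0 0 ∧ ‖g‖ ≤ C}

/-- `J_{1α}(g) = ½ ‖Φ g - ν‖² + (α/2) ‖g'‖²`. -/
def J1 {ℓ T : ℝ} (ρ μ : Lp ℝ ⊤ (vol 0 ℓ)) (r κ : Sobolev 0 ℓ 2) (ν : L2 0 T) (α : ℝ)
    (g : Sobolev 0 T 1) : ℝ :=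
  1 / 2 * ‖Phi ρ μ r κ (Sobolev.D 0 g) - ν‖ ^ 2 + α / 2 * ‖Sobolev.D 1 g‖ ^ 2

/-- `J_{2α}(g) = ½ ‖Ψ g - ω‖² + (α/2) ‖g'''‖²`. -/
def J2 {ℓ T : ℝ} (ρ μ : Lp ℝ ⊤ (vol 0 ℓ)) (r κ : Sobolev 0 ℓ 2) (ω : L2 0 T) (α : ℝ)
    (g : Sobolev 0 T 3) : ℝ :=
  1 / 2 * ‖Psi ρ μ r κ (Sobolev.D 0 g) - ω‖ ^ 2 + α / 2 * ‖Sobolev.D 3 g‖ ^ 2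

end

end KelvinVoigtBeam

/-! Everything is expressed through the Volterra operator J (integration from 0), used both in x and
in t. Because v(0) = v_x(0) = 0, the map v ↦ v_xx identifies the space `V ℓ` with L²(0, ℓ), with
inverse K = J² in x for the function itself, and v(ℓ) is the pairing of v_xx with ℓ - x. In the
unknowns y = u_tt and z = u_xxt the weak problem becomes K z = J y (both sides are u_t) together
with K*ρ y + (κ + K*μK) z + r J z = g(t)(ℓ - x). The zero initial data are built into J in time
(`evolutionOp`, `equation_iff`).

Uniqueness is an energy argument: ⟨f, J f⟩ = ½‖∫ f‖² ≥ 0, so testing the second equation with z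
forces z = 0 (`evolutionOp_injective`). Existence comes from Lions' projection lemma
(`exists_of_coercive_pairing`) and the estimate `evolution_coercive`. Writing g = J g' lets the load
be integrated by parts in time, which gives a bound by g'. Hence g' ↦ (u_tt, u_xxt) is a bounded
linear operator.

The deflection is a bounded linear image of z. For the moment, the equation reads κ z + r J z = g(ℓ
- x) - K*(ρ y + μ K z), and the right side is continuous in x because K* integrates twice from the
right end. Solving this Volterra equation in the Banach algebra C[0, ℓ]
(`exists_add_mul_volterra_eq`) shows that u_xx and u_xxt are continuous in x for a.e. t, and the
moment at x = 0 is again bounded and linear in the data.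

Parametrized by h = g' (respectively h = g'''), each Tikhonov functional is ½‖S h - b‖² + (α/2)‖h‖²
on a closed convex set. Minimizing it is a nearest-point problem in a Hilbert space, so the
minimizer exists and is unique. -/

namespace KelvinVoigtBeam

noncomputable section

/-! ### Primitives of vector-valued functions and integration by parts. -/

section Primitive

variable {T : ℝ} {E F G : Type*} [NormedAddCommGroup E] [NormedSpace ℝ E]
  [NormedAddCommGroup F] [NormedSpace ℝ F] [NormedAddCommGroup G] [NormedSpace ℝ G]

/-- The primitive `t ↦ ∫₀ᵗ f` of a function on `(0, T)`. -/
def prim (T : ℝ) (f : ℝ → E) (t : ℝ) : E := ∫ s in Iic t, f s ∂(vol 0 T)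

theorem prim_congr_ae {f g : ℝ → E} (h : f =ᵐ[vol 0 T] g) : prim T f = prim T g := by
  funext t
  exact integral_congr_ae (ae_restrict_of_ae h)

theorem continuous_prim {f : ℝ → E} (hf : Integrable f (vol 0 T)) : Continuous (prim T f) := by
  have h : prim T f = fun t => (∫ s in Iic 0, f s ∂(vol 0 T)) + ∫ s in (0 : ℝ)..t, f s ∂(vol 0 T) := by
    funext t
    rw [← intervalIntegral.integral_Iic_sub_Iic hf.integrableOn hf.integrableOn]
    simp [prim]
  rw [h]
  exact continuous_const.add (hf.continuous_primitive 0)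

theorem prim_of_nonpos (f : ℝ → E) {t : ℝ} (ht : t ≤ 0) : prim T f t = 0 := by
  have h : Iic t ∩ Ioo 0 T = ∅ := by
    ext x
    simp only [mem_inter_iff, mem_Iic, mem_Ioo, mem_empty_iff_false, iff_false]
    rintro ⟨h1, h2, -⟩
    linarith
  rw [prim, Measure.restrict_restrict measurableSet_Iic, h]
  simp

theorem prim_of_le (f : ℝ → E) {t : ℝ} (ht : T ≤ t) : prim T f t = ∫ s, f s ∂(vol 0 T) := by
  have h : Iic t ∩ Ioo 0 T = Ioo 0 T := by
    ext x
    simp only [mem_inter_iff, mem_Iic, mem_Ioo, and_iff_right_iff_imp]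
    rintro ⟨h1, h2⟩
    linarith
  rw [prim, Measure.restrict_restrict measurableSet_Iic, h]

theorem prim_eq_intervalIntegral (f : ℝ → E) {t : ℝ} (ht : t ∈ Icc 0 T) :
    prim T f t = ∫ s in (0 : ℝ)..t, f s := by
  have h : (Iic t ∩ Ioo 0 T : Set ℝ) =ᵐ[volume] Ioc 0 t := by
    rcases eq_or_lt_of_le ht.2 with h | h
    · subst h
      have : Iic t ∩ Ioo 0 t = Ioo 0 t := inter_eq_right.2 fun x hx => hx.2.le
      rw [this]
      exact Ioo_ae_eq_Ioc
    · have : Iic t ∩ Ioo 0 T = Ioc 0 t := by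
        ext x
        simp only [mem_inter_iff, mem_Iic, mem_Ioo, mem_Ioc]
        exact ⟨fun hx => ⟨hx.2.1, hx.1⟩, fun hx => ⟨hx.2, hx.1, hx.2.trans_lt h⟩⟩
      rw [this]
      exact Filter.EventuallyEq.rfl
  rw [prim, Measure.restrict_restrict measurableSet_Iic, intervalIntegral.integral_of_le ht.1,
    Measure.restrict_congr_set h]

theorem norm_prim_le {f : ℝ → E} (hf : Integrable f (vol 0 T)) (t : ℝ) :
    ‖prim T f t‖ ≤ ∫ s, ‖f s‖ ∂(vol 0 T) :=
  (norm_integral_le_integral_norm _).trans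
    (integral_mono_measure Measure.restrict_le_self
      (Filter.Eventually.of_forall fun _ => norm_nonneg _) hf.norm)

theorem prim_comp [CompleteSpace E] [CompleteSpace F] (A : E →L[ℝ] F) {f : ℝ → E}
    (hf : Integrable f (vol 0 T)) (t : ℝ) : prim T (fun s => A (f s)) t = A (prim T f t) :=
  A.integral_comp_comm hf.integrableOn

/-- Integration by parts for primitives that vanish at `0`. -/
theorem integral_prim_add_integral_prim [CompleteSpace E] [CompleteSpace F] [CompleteSpace G]
    (B : E →L[ℝ] F →L[ℝ] G) {f : ℝ → E} {g : ℝ → F}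
    (hf : Integrable f (vol 0 T)) (hg : Integrable g (vol 0 T)) :
    (∫ t, B (prim T f t) (g t) ∂(vol 0 T)) + ∫ t, B (f t) (prim T g t) ∂(vol 0 T)
      = B (∫ t, f t ∂(vol 0 T)) (∫ t, g t ∂(vol 0 T)) := by
  -- Fubini on the square: the two integrals on the left are those of B (f s) (g t) over s ≤ t and
  -- over s > t, and together they fill the square.
  set ν := vol 0 T with hν
  have hint : Integrable (fun z : ℝ × ℝ => B (f z.1) (g z.2)) (ν.prod ν) :=
    hf.op_fst_snd (by fun_prop) ⟨‖B‖, B.le_opNorm₂⟩ hg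
  have hS : MeasurableSet {z : ℝ × ℝ | z.1 ≤ z.2} := measurableSet_le measurable_fst measurable_snd
  have h1 : ∫ t, B (prim T f t) (g t) ∂ν
      = ∫ z in {z : ℝ × ℝ | z.1 ≤ z.2}, B (f z.1) (g z.2) ∂(ν.prod ν) := by
    rw [← integral_indicator hS, integral_prod_symm _ (hint.indicator hS)]
    refine integral_congr_ae (Filter.Eventually.of_forall fun t => ?_)
    change B.flip (g t) (prim T f t) = _
    rw [prim, ← ContinuousLinearMap.integral_comp_comm _ hf.integrableOn,
      ← integral_indicator measurableSet_Iic]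
    refine integral_congr_ae (Filter.Eventually.of_forall fun s => ?_)
    simp [indicator]
  have h2 : ∫ t, B (f t) (prim T g t) ∂ν
      = ∫ z in {z : ℝ × ℝ | z.1 ≤ z.2}ᶜ, B (f z.1) (g z.2) ∂(ν.prod ν) := by
    rw [← integral_indicator hS.compl, integral_prod _ (hint.indicator hS.compl)]
    refine integral_congr_ae (Filter.Eventually.of_forall fun t => ?_)
    change B (f t) (prim T g t) = _
    -- The complement of s ≤ t is a strict inequality, so the primitive is first rewritten over an
    -- open half-line; the diagonal is a null set.
    rw [prim, setIntegral_congr_set Iio_ae_eq_Iic.symm,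
      ← ContinuousLinearMap.integral_comp_comm _ hg.integrableOn,
      ← integral_indicator measurableSet_Iio]
    refine integral_congr_ae (Filter.Eventually.of_forall fun s => ?_)
    simp [indicator]
  rw [h1, h2, integral_add_compl hS hint, integral_prod_bilin B hf hg]

end Primitive

/-! ### Weak derivatives and du Bois-Reymond's lemma. -/

section WeakDeriv

variable {T : ℝ} {E F : Type*} [NormedAddCommGroup E] [NormedSpace ℝ E]
  [NormedAddCommGroup F] [NormedSpace ℝ F]

theorem IsWeakDeriv.congr {f f' g g' : ℝ → E} (h : IsWeakDeriv 0 T f f')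
    (hf : f =ᵐ[vol 0 T] g) (hf' : f' =ᵐ[vol 0 T] g') : IsWeakDeriv 0 T g g' := by
  intro φ hφ hc hs
  have h1 : ∫ x, deriv φ x • g x ∂(vol 0 T) = ∫ x, deriv φ x • f x ∂(vol 0 T) :=
    integral_congr_ae (by filter_upwards [hf] with x hx; rw [hx])
  have h2 : ∫ x, φ x • g' x ∂(vol 0 T) = ∫ x, φ x • f' x ∂(vol 0 T) :=
    integral_congr_ae (by filter_upwards [hf'] with x hx; rw [hx])
  rw [h1, h2, h φ hφ hc hs]

theorem integrable_smul_of_hasCompactSupport {ψ : ℝ → ℝ} (hψ : Continuous ψ)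
    (hc : HasCompactSupport ψ) {f : ℝ → E} (hf : Integrable f (vol 0 T)) :
    Integrable (fun x => ψ x • f x) (vol 0 T) := by
  obtain ⟨C, hC⟩ := hc.exists_bound_of_continuous hψ
  exact hf.bdd_smul C hψ.aestronglyMeasurable (Filter.Eventually.of_forall hC)

theorem IsWeakDeriv.comp [CompleteSpace E] [CompleteSpace F] {f f' : ℝ → E}
    (h : IsWeakDeriv 0 T f f') (A : E →L[ℝ] F)
    (hf : Integrable f (vol 0 T)) (hf' : Integrable f' (vol 0 T)) :
    IsWeakDeriv 0 T (fun t => A (f t)) (fun t => A (f' t)) := by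
  intro φ hφ hc hs
  have h1 := integrable_smul_of_hasCompactSupport (hφ.continuous_deriv (by simp)) hc.deriv hf
  have h2 := integrable_smul_of_hasCompactSupport hφ.continuous hc hf'
  simp only [← map_smul]
  rw [A.integral_comp_comm h1, A.integral_comp_comm h2, h φ hφ hc hs, map_neg]

theorem prim_eq_of_hasDerivAt [CompleteSpace E] {φ φ' : ℝ → E} (h : ∀ t, HasDerivAt φ (φ' t) t) (hφ' : Continuous φ')
    {t : ℝ} (ht : t ∈ Icc 0 T) : prim T φ' t = φ t - φ 0 := by
  rw [prim_eq_intervalIntegral _ ht]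
  exact intervalIntegral.integral_eq_sub_of_hasDerivAt (fun x _ => h x)
    (hφ'.intervalIntegrable _ _)

theorem isWeakDeriv_prim [CompleteSpace E] (hT : 0 < T) {f : ℝ → E}
    (hf : Integrable f (vol 0 T)) : IsWeakDeriv 0 T (prim T f) f := by
  intro φ hφ hc hs
  have h0 : φ 0 = 0 := image_eq_zero_of_notMem_tsupport fun h => lt_irrefl _ (hs h).1
  have h1 : φ T = 0 := image_eq_zero_of_notMem_tsupport fun h => lt_irrefl _ (hs h).2
  have hd : ∀ t, HasDerivAt φ (deriv φ t) t := fun t =>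
    (hφ.differentiable (by simp)).differentiableAt.hasDerivAt
  have hcd : Continuous (deriv φ) := hφ.continuous_deriv (by simp)
  have hi : Integrable (deriv φ) (vol 0 T) := (hcd.integrable_of_hasCompactSupport hc.deriv).restrict
  have key := integral_prim_add_integral_prim (ContinuousLinearMap.lsmul ℝ ℝ (E := E)) hi hf
  have hT' : ∫ t, deriv φ t ∂(vol 0 T) = 0 := by
    rw [← prim_of_le _ le_rfl, prim_eq_of_hasDerivAt hd hcd ⟨hT.le, le_rfl⟩, h0, h1, sub_zero]
  have hφp : ∫ t, prim T (deriv φ) t • f t ∂(vol 0 T) = ∫ t, φ t • f t ∂(vol 0 T) := by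
    refine setIntegral_congr_fun measurableSet_Ioo fun t ht => ?_
    rw [prim_eq_of_hasDerivAt hd hcd (Ioo_subset_Icc_self ht), h0, sub_zero]
  simp only [ContinuousLinearMap.lsmul_apply] at key
  rw [hT', zero_smul, hφp] at key
  exact eq_neg_of_add_eq_zero_right key

/-- A smooth function with compact support in `(0, T)` and integral `0` has a primitive of the same
kind. -/
theorem exists_test_primitive {ψ : ℝ → ℝ} (hψ : ContDiff ℝ ((⊤ : ℕ∞) : WithTop ℕ∞) ψ)
    (hc : HasCompactSupport ψ) (hs : tsupport ψ ⊆ Ioo 0 T) (h0 : ∫ x, ψ x ∂(vol 0 T) = 0) :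
    ∃ φ : ℝ → ℝ, ContDiff ℝ ((⊤ : ℕ∞) : WithTop ℕ∞) φ ∧ HasCompactSupport φ ∧
      tsupport φ ⊆ Ioo 0 T ∧ deriv φ = ψ := by
  have hcont := hψ.continuous
  set φ : ℝ → ℝ := fun t => ∫ s in (0 : ℝ)..t, ψ s with hφ
  have hd : ∀ t, HasDerivAt φ (ψ t) t := fun t =>
    intervalIntegral.integral_hasDerivAt_right (hcont.intervalIntegrable _ _)
      (hcont.stronglyMeasurableAtFilter _ _) hcont.continuousAt
  have hder : deriv φ = ψ := funext fun t => (hd t).deriv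
  rcases (tsupport ψ).eq_empty_or_nonempty with he | hne
  · have hz : ψ = 0 := by
      rwa [tsupport_eq_empty_iff] at he
    exact ⟨0, contDiff_const, HasCompactSupport.zero, by simp, by rw [hz]; ext; simp⟩
  -- The primitive vanishes to the left of the least support point a by definition, and to the right
  -- of the greatest point b because the total integral is 0.
  obtain ⟨a, ha⟩ := hc.isCompact.exists_isLeast hne
  obtain ⟨b, hb⟩ := hc.isCompact.exists_isGreatest hne
  have ha0 := hs ha.1
  have hb0 := hs hb.1
  have hout : ∀ x, x ∉ Icc a b → ψ x = 0 := fun x hx =>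
    image_eq_zero_of_notMem_tsupport fun h => hx ⟨ha.2 h, hb.2 h⟩
  have hTz : ∫ s in (0 : ℝ)..T, ψ s = 0 := by
    rw [intervalIntegral.integral_of_le (ha0.1.trans ha0.2).le, integral_Ioc_eq_integral_Ioo]
    exact h0
  have hφ0 : ∀ t, t ∉ Icc a b → φ t = 0 := by
    intro t ht
    rcases lt_or_ge t a with h | h
    · have : EqOn ψ 0 (uIcc 0 t) := by
        intro s hs
        refine hout s fun hs' => ?_
        have := hs.2
        have : s < a := by
          refine lt_of_le_of_lt hs.2 (max_lt ha0.1 h)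
        exact absurd hs'.1 (not_le.2 this)
      simp only [hφ]
      rw [intervalIntegral.integral_congr this]
      simp
    · have hbt : b < t := by
        by_contra hcon
        exact ht ⟨h, not_lt.1 hcon⟩
      have : EqOn ψ 0 (uIcc T t) := by
        intro s hs
        refine hout s fun hs' => ?_
        have : b < s := lt_of_lt_of_le (lt_min hb0.2 hbt) hs.1
        exact absurd hs'.2 (not_le.2 this)
      have h2 := intervalIntegral.integral_add_adjacent_intervals
        (hcont.intervalIntegrable (μ := volume) 0 T) (hcont.intervalIntegrable T t)
      simp only [hφ]
      rw [← h2, hTz, intervalIntegral.integral_congr this]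
      simp
  have hsub : tsupport φ ⊆ Icc a b :=
    closure_minimal (fun t ht => by_contra fun h => ht (hφ0 t h)) isClosed_Icc
  refine ⟨φ, ?_, HasCompactSupport.of_support_subset_isCompact isCompact_Icc
    (subset_tsupport φ |>.trans hsub), hsub.trans fun t ht => ⟨ha0.1.trans_le ht.1,
      ht.2.trans_lt hb0.2⟩, hder⟩
  rw [contDiff_infty_iff_deriv]
  exact ⟨fun t => (hd t).differentiableAt, hder ▸ hψ⟩

/-- The lemma of du Bois-Reymond. -/
theorem IsWeakDeriv.ae_eq_const [CompleteSpace E] (hT : 0 < T) {f : ℝ → E}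
    (hf : Integrable f (vol 0 T)) (h : IsWeakDeriv 0 T f 0) : ∃ c : E, ∀ᵐ t ∂(vol 0 T), f t = c := by
  obtain ⟨η, hη, hηc, hηs, hηi⟩ : ∃ η : ℝ → ℝ, ContDiff ℝ ((⊤ : ℕ∞) : WithTop ℕ∞) η ∧
      HasCompactSupport η ∧ tsupport η ⊆ Ioo 0 T ∧ ∫ x, η x ∂(vol 0 T) = 1 := by
    let b : ContDiffBump (T / 2) := ⟨T / 8, T / 4, by linarith, by linarith⟩
    have hts : tsupport (b.normed volume) ⊆ Ioo 0 T := by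
      rw [b.tsupport_normed_eq, Real.closedBall_eq_Icc]
      intro x hx
      have h1 : T / 2 - T / 4 ≤ x := hx.1
      have h2 : x ≤ T / 2 + T / 4 := hx.2
      constructor <;> linarith
    refine ⟨b.normed volume, b.contDiff_normed, b.hasCompactSupport_normed, hts, ?_⟩
    rw [setIntegral_eq_integral_of_forall_compl_eq_zero]
    · exact b.integral_normed
    · exact fun x hx => image_eq_zero_of_notMem_tsupport fun hx' => hx (hts hx')
  refine ⟨∫ x, η x • f x ∂(vol 0 T), ?_⟩
  set c := ∫ x, η x • f x ∂(vol 0 T) with hc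
  have hloc : LocallyIntegrableOn (fun t => f t - c) (Ioo 0 T) volume := by
    have : IntegrableOn (fun t => f t - c) (Ioo 0 T) volume := hf.sub (integrable_const c)
    exact this.locallyIntegrableOn
  have := isOpen_Ioo.ae_eq_zero_of_integral_contDiff_smul_eq_zero hloc ?_
  · rw [ae_restrict_iff' measurableSet_Ioo]
    filter_upwards [this] with t ht htT
    exact sub_eq_zero.1 (ht htT)
  intro ψ hψ hψc hψs
  set m := ∫ x, ψ x ∂(vol 0 T) with hm
  have hψi : Integrable ψ (vol 0 T) := (hψ.continuous.integrable_of_hasCompactSupport hψc).restrict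
  have hηi' : Integrable η (vol 0 T) :=
    (hη.continuous.integrable_of_hasCompactSupport hηc).restrict
  -- Subtracting m times the unit-mass bump η leaves a function of integral 0, that is, the
  -- derivative of a test function. Testing f with it gives ∫ ψ f = m ∫ η f, so f - c is orthogonal
  -- to every ψ.
  obtain ⟨φ, hφ, hφc, hφs, hφd⟩ := exists_test_primitive (T := T) (ψ := fun x => ψ x - m * η x)
    (hψ.sub (contDiff_const.mul hη)) (hψc.sub (hηc.mul_left (f := fun _ => m)))
    ((tsupport_sub _ _).trans (union_subset hψs
      ((tsupport_mul_subset_right (f := fun _ => m)).trans hηs)))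
    (by rw [integral_sub hψi (hηi'.const_mul m), integral_const_mul, hηi]; simp [hm])
  have key := h φ hφ hφc hφs
  rw [hφd] at key
  simp only [Pi.zero_apply, smul_zero, integral_zero, neg_zero, sub_smul, mul_smul] at key
  have i1 := integrable_smul_of_hasCompactSupport hψ.continuous hψc hf
  have i2 := integrable_smul_of_hasCompactSupport hη.continuous hηc hf
  have i3 : Integrable (fun x => m • η x • f x) (vol 0 T) := i2.smul m
  rw [integral_sub i1 i3, integral_smul, sub_eq_zero] at key
  have hset : ∫ x, ψ x • (f x - c) = ∫ x, ψ x • (f x - c) ∂(vol 0 T) := by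
    rw [setIntegral_eq_integral_of_forall_compl_eq_zero]
    intro x hx
    rw [image_eq_zero_of_notMem_tsupport fun hx' => hx (hψs hx'), zero_smul]
  rw [hset]
  simp only [smul_sub]
  rw [integral_sub i1 (hψi.smul_const c), key, integral_smul_const, sub_self]

/-- A function with weak derivative `f'` is a primitive of `f'`. -/
theorem IsWeakDeriv.exists_ae_eq_add_prim [CompleteSpace E] (hT : 0 < T) {f f' : ℝ → E}
    (hf : Integrable f (vol 0 T)) (hf' : Integrable f' (vol 0 T)) (h : IsWeakDeriv 0 T f f') :
    ∃ c : E, f =ᵐ[vol 0 T] fun t => c + prim T f' t := by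
  have hp : Integrable (prim T f') (vol 0 T) :=
    ((continuous_prim hf').integrableOn_Icc (a := 0) (b := T)).mono_set Ioo_subset_Icc_self
  have hw : IsWeakDeriv 0 T (fun t => f t - prim T f' t) 0 := by
    intro φ hφ hc hs
    have c1 := hφ.continuous_deriv (by simp)
    simp only [smul_sub, Pi.zero_apply, smul_zero, integral_zero, neg_zero]
    rw [integral_sub (integrable_smul_of_hasCompactSupport c1 hc.deriv hf)
      (integrable_smul_of_hasCompactSupport c1 hc.deriv hp), h φ hφ hc hs,
      isWeakDeriv_prim hT hf' φ hφ hc hs, sub_self]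
  obtain ⟨c, hc⟩ : ∃ c, ∀ᵐ t ∂(vol 0 T), f t - prim T f' t = c := hw.ae_eq_const hT (hf.sub hp)
  refine ⟨c, ?_⟩
  filter_upwards [hc] with t ht
  rw [← ht, sub_add_cancel]

/-- A function with weak derivative `f'` and initial value `0` is the primitive of `f'`. -/
theorem IsWeakDeriv.ae_eq_prim [CompleteSpace E] (hT : 0 < T) {f f' : ℝ → E}
    (hf : Integrable f (vol 0 T)) (hf' : Integrable f' (vol 0 T)) (h : IsWeakDeriv 0 T f f')
    (h0 : HasValueAt 0 T f 0 0) : f =ᵐ[vol 0 T] prim T f' := by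
  obtain ⟨c, hc⟩ := h.exists_ae_eq_add_prim hT hf hf'
  have h1 : HasValueAt 0 T f 0 c :=
    ⟨fun t => c + prim T f' t, (continuous_const.add (continuous_prim hf')).continuousOn, hc.symm,
      by simp [prim_of_nonpos]⟩
  have h2 : 0 = c := h0.unique hT ⟨le_rfl, hT.le⟩ h1
  filter_upwards [hc] with t ht
  rw [ht, ← h2, zero_add]

/-- The weak derivative of `0` is `0`. -/
theorem ae_eq_zero_of_isWeakDeriv_zero [CompleteSpace E] {f' : ℝ → E}
    (hf' : Integrable f' (vol 0 T)) (h : IsWeakDeriv 0 T 0 f') : f' =ᵐ[vol 0 T] 0 := by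
  have hloc : LocallyIntegrableOn f' (Ioo 0 T) volume := IntegrableOn.locallyIntegrableOn hf'
  have := isOpen_Ioo.ae_eq_zero_of_integral_contDiff_smul_eq_zero hloc ?_
  · rw [Filter.EventuallyEq, ae_restrict_iff' measurableSet_Ioo]
    exact this
  intro ψ hψ hψc hψs
  rw [← setIntegral_eq_integral_of_forall_compl_eq_zero (s := Ioo 0 T)]
  · have := h ψ hψ hψc hψs
    simpa using this.symm
  · intro x hx
    rw [image_eq_zero_of_notMem_tsupport fun hx' => hx (hψs hx'), zero_smul]

end WeakDeriv

/-! ### The Volterra operator on L²(0, T; E). -/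

section Volterra

variable {T : ℝ} {E F : Type*} [NormedAddCommGroup E] [NormedSpace ℝ E]
  [NormedAddCommGroup F] [NormedSpace ℝ F]

omit [NormedSpace ℝ E] in
theorem integrable_coeFn (f : Lp E 2 (vol 0 T)) : Integrable f (vol 0 T) :=
  (Lp.memLp f).integrable (by norm_num)

theorem exists_integral_norm_le (T : ℝ) (E : Type*) [NormedAddCommGroup E] :
    ∃ C : ℝ, 0 ≤ C ∧ ∀ f : Lp E 2 (vol 0 T), ∫ s, ‖f s‖ ∂(vol 0 T) ≤ C * ‖f‖ := by
  refine ⟨(vol 0 T univ ^ (1 / (1 : ENNReal).toReal - 1 / (2 : ENNReal).toReal)).toReal,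
    ENNReal.toReal_nonneg, fun f => ?_⟩
  have h := eLpNorm_le_eLpNorm_mul_rpow_measure_univ (p := 1) (q := 2) (by norm_num)
    (Lp.aestronglyMeasurable f)
  rw [integral_norm_eq_lintegral_enorm (Lp.aestronglyMeasurable f), ← eLpNorm_one_eq_lintegral_enorm,
    Lp.norm_def, mul_comm, ← ENNReal.toReal_mul]
  refine ENNReal.toReal_mono (ENNReal.mul_ne_top (Lp.eLpNorm_ne_top f) ?_) h
  exact (ENNReal.rpow_lt_top_of_nonneg (by norm_num) (measure_ne_top _ _)).ne

/-- A constant `C` with `∫ ‖f‖ ≤ C ‖f‖_{L²(0, T)}`. -/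
def l1Const (T : ℝ) (E : Type*) [NormedAddCommGroup E] : ℝ := (exists_integral_norm_le T E).choose

theorem l1Const_nonneg (T : ℝ) (E : Type*) [NormedAddCommGroup E] : 0 ≤ l1Const T E :=
  (exists_integral_norm_le T E).choose_spec.1

omit [NormedSpace ℝ E] in
theorem integral_norm_le (f : Lp E 2 (vol 0 T)) :
    ∫ s, ‖f s‖ ∂(vol 0 T) ≤ l1Const T E * ‖f‖ :=
  (exists_integral_norm_le T E).choose_spec.2 f

/-- The integral over `(0, T)` as a bounded operator on `L²(0, T; E)`. -/
def integralL (T : ℝ) (E : Type*) [NormedAddCommGroup E] [NormedSpace ℝ E] :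
    Lp E 2 (vol 0 T) →L[ℝ] E :=
  LinearMap.mkContinuous
    { toFun := fun f => ∫ s, f s ∂(vol 0 T)
      map_add' := fun f g => by
        rw [← integral_add (integrable_coeFn f) (integrable_coeFn g)]
        exact integral_congr_ae (Lp.coeFn_add f g)
      map_smul' := fun c f => by
        rw [RingHom.id_apply, ← integral_smul]
        exact integral_congr_ae (Lp.coeFn_smul c f) }
    (l1Const T E) fun f => (norm_integral_le_integral_norm _).trans (integral_norm_le f)

theorem integralL_apply (f : Lp E 2 (vol 0 T)) : integralL T E f = ∫ s, f s ∂(vol 0 T) := rfl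

theorem prim_add {f g : ℝ → E} (hf : Integrable f (vol 0 T)) (hg : Integrable g (vol 0 T)) (t : ℝ) :
    prim T (f + g) t = prim T f t + prim T g t :=
  integral_add hf.integrableOn hg.integrableOn

theorem prim_smul (c : ℝ) (f : ℝ → E) (t : ℝ) : prim T (c • f) t = c • prim T f t :=
  integral_smul _ _

omit [NormedSpace ℝ E] in
theorem memLp_of_continuous {f : ℝ → E} (hf : Continuous f) : MemLp f 2 (vol 0 T) := by
  obtain ⟨C, hC⟩ := isCompact_Icc.exists_bound_of_continuousOn (s := Icc 0 T) hf.continuousOn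
  refine MemLp.of_bound ?_ C ?_
  · exact (hf.continuousOn (s := Icc 0 T)).aestronglyMeasurable_of_isCompact isCompact_Icc
      measurableSet_Icc |>.mono_measure (Measure.restrict_mono Ioo_subset_Icc_self le_rfl)
  · exact ae_restrict_of_forall_mem measurableSet_Ioo fun x hx => hC x (Ioo_subset_Icc_self hx)

theorem memLp_prim (f : Lp E 2 (vol 0 T)) : MemLp (prim T f) 2 (vol 0 T) :=
  memLp_of_continuous (continuous_prim (integrable_coeFn f))

/-- The Volterra operator `(J f)(t) = ∫₀ᵗ f` on `L²(0, T; E)`. -/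
def volterra (T : ℝ) (E : Type*) [NormedAddCommGroup E] [NormedSpace ℝ E] :
    Lp E 2 (vol 0 T) →L[ℝ] Lp E 2 (vol 0 T) :=
  LinearMap.mkContinuous
    { toFun := fun f => (memLp_prim f).toLp
      map_add' := fun f g => by
        rw [← MemLp.toLp_add]
        refine MemLp.toLp_congr _ _ (Filter.Eventually.of_forall fun t => ?_)
        rw [prim_congr_ae (Lp.coeFn_add f g), prim_add (integrable_coeFn f) (integrable_coeFn g)]
        rfl
      map_smul' := fun c f => by
        rw [RingHom.id_apply, ← MemLp.toLp_const_smul]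
        refine MemLp.toLp_congr _ _ (Filter.Eventually.of_forall fun t => ?_)
        rw [prim_congr_ae (Lp.coeFn_smul c f), prim_smul]
        rfl }
    (measureUnivNNReal (vol 0 T) ^ (2 : ENNReal).toReal⁻¹ * l1Const T E) fun f => by
      rw [mul_assoc]
      refine (Lp.norm_le_of_ae_bound (C := l1Const T E * ‖f‖)
        (mul_nonneg (l1Const_nonneg T E) (norm_nonneg _)) ?_).trans_eq ?_
      · filter_upwards [(memLp_prim f).coeFn_toLp] with t ht
        exact (congrArg norm ht).trans_le ((norm_prim_le (integrable_coeFn f) t).trans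
          (integral_norm_le f))
      · simp

theorem coeFn_volterra (f : Lp E 2 (vol 0 T)) : volterra T E f =ᵐ[vol 0 T] prim T f :=
  (memLp_prim f).coeFn_toLp

theorem hasValueAt_prim {f : ℝ → E} (hf : Integrable f (vol 0 T)) {g : ℝ → E}
    (hg : g =ᵐ[vol 0 T] prim T f) (t : ℝ) : HasValueAt 0 T g t (prim T f t) :=
  ⟨prim T f, (continuous_prim hf).continuousOn, hg.symm, rfl⟩

theorem hasValueAt_volterra_zero (f : Lp E 2 (vol 0 T)) :
    HasValueAt 0 T (volterra T E f) 0 0 := by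
  have := hasValueAt_prim (integrable_coeFn f) (coeFn_volterra f) 0
  rwa [prim_of_nonpos _ le_rfl] at this

theorem hasValueAt_volterra_right (f : Lp E 2 (vol 0 T)) :
    HasValueAt 0 T (volterra T E f) T (integralL T E f) := by
  have := hasValueAt_prim (integrable_coeFn f) (coeFn_volterra f) T
  rwa [prim_of_le _ le_rfl] at this

theorem isWeakDeriv_volterra [CompleteSpace E] (hT : 0 < T) (f : Lp E 2 (vol 0 T)) :
    IsWeakDeriv 0 T (volterra T E f) f :=
  (isWeakDeriv_prim hT (integrable_coeFn f)).congr (coeFn_volterra f).symm Filter.EventuallyEq.rfl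

/-- Turns a differential relation with zero initial value into an identity between bounded
operators. It is applied in time for u and u_t, in space for elements of `V ℓ`, and to the controls
g. -/
theorem IsWeakDeriv.eq_volterra [CompleteSpace E] (hT : 0 < T) {f f' : Lp E 2 (vol 0 T)}
    (h : IsWeakDeriv 0 T f f') (h0 : HasValueAt 0 T f 0 0) : f = volterra T E f' :=
  Lp.ext ((h.ae_eq_prim hT (integrable_coeFn f) (integrable_coeFn f') h0).trans
    (coeFn_volterra f').symm)

theorem volterra_injective [CompleteSpace E] (hT : 0 < T) {f : Lp E 2 (vol 0 T)}
    (hf : volterra T E f = 0) : f = 0 := by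
  have h := isWeakDeriv_volterra hT f
  rw [hf] at h
  exact Lp.ext ((ae_eq_zero_of_isWeakDeriv_zero (integrable_coeFn f)
    (h.congr (Lp.coeFn_zero _ _ _) Filter.EventuallyEq.rfl)).trans (Lp.coeFn_zero _ _ _).symm)

theorem integralL_compLpL [CompleteSpace E] [CompleteSpace F] (A : E →L[ℝ] F)
    (f : Lp E 2 (vol 0 T)) :
    integralL T F (A.compLpL 2 (vol 0 T) f) = A (integralL T E f) := by
  rw [integralL_apply, integralL_apply, ← A.integral_comp_comm (integrable_coeFn f)]
  exact integral_congr_ae (A.coeFn_compLpL f)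

theorem volterra_compLpL [CompleteSpace E] [CompleteSpace F] (A : E →L[ℝ] F)
    (f : Lp E 2 (vol 0 T)) :
    volterra T F (A.compLpL 2 (vol 0 T) f) = A.compLpL 2 (vol 0 T) (volterra T E f) := by
  refine Lp.ext ((coeFn_volterra _).trans ?_)
  filter_upwards [A.coeFn_compLpL (volterra T E f), coeFn_volterra f] with t h1 h2
  rw [h1, h2, prim_congr_ae (A.coeFn_compLpL f)]
  exact prim_comp A (integrable_coeFn f) t

end Volterra

/-! ### Quadratic forms with the Volterra operator. -/

section Inner

variable {T : ℝ} {E F : Type*} [NormedAddCommGroup E] [InnerProductSpace ℝ E] [CompleteSpace E]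
  [NormedAddCommGroup F] [InnerProductSpace ℝ F] [CompleteSpace F]

/-- Integration by parts for the inner product. The symmetric part of J is thus carried by the total
integral alone, which is the source of every positivity statement in the energy estimates. -/
theorem inner_volterra_add_inner_volterra (f g : Lp E 2 (vol 0 T)) :
    inner ℝ (volterra T E f) g + inner ℝ f (volterra T E g)
      = inner ℝ (integralL T E f) (integralL T E g) := by
  rw [L2.inner_def, L2.inner_def]
  have key : (∫ t, inner ℝ (prim T f t) (g t) ∂(vol 0 T))
      + ∫ t, inner ℝ (f t) (prim T g t) ∂(vol 0 T)
      = inner ℝ (∫ t, f t ∂(vol 0 T)) (∫ t, g t ∂(vol 0 T)) :=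
    integral_prim_add_integral_prim (innerSL ℝ) (integrable_coeFn f) (integrable_coeFn g)
  rw [integralL_apply, integralL_apply, ← key]
  congr 1
  · refine integral_congr_ae ?_
    filter_upwards [coeFn_volterra f] with t ht
    rw [ht]
  · refine integral_congr_ae ?_
    filter_upwards [coeFn_volterra g] with t ht
    rw [ht]

theorem inner_compLpL_left (A : E →L[ℝ] F) (f : Lp E 2 (vol 0 T)) (g : Lp F 2 (vol 0 T)) :
    inner ℝ (A.compLpL 2 (vol 0 T) f) g
      = inner ℝ f ((ContinuousLinearMap.adjoint A).compLpL 2 (vol 0 T) g) := by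
  rw [L2.inner_def, L2.inner_def]
  refine integral_congr_ae ?_
  filter_upwards [A.coeFn_compLpL f, (ContinuousLinearMap.adjoint A).coeFn_compLpL g] with t h1 h2
  rw [h1, h2, ContinuousLinearMap.adjoint_inner_right]

theorem inner_compLpL_symm {A : E →L[ℝ] E} (hA : ∀ x y, inner ℝ (A x) y = inner ℝ x (A y))
    (f g : Lp E 2 (vol 0 T)) :
    inner ℝ (A.compLpL 2 (vol 0 T) f) g = inner ℝ f (A.compLpL 2 (vol 0 T) g) := by
  rw [inner_compLpL_left, ← (ContinuousLinearMap.eq_adjoint_iff _ _).2 hA]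

omit [CompleteSpace E] in
/-- A pointwise lower bound for a quadratic form carries over to `L²(0, T; E)`. -/
theorem inner_compLpL_self_ge (A : E →L[ℝ] E) {c : ℝ} (h : ∀ x, c * ‖x‖ ^ 2 ≤ inner ℝ (A x) x)
    (f : Lp E 2 (vol 0 T)) :
    c * ‖f‖ ^ 2 ≤ inner ℝ (A.compLpL 2 (vol 0 T) f) f := by
  rw [← real_inner_self_eq_norm_sq, L2.inner_def, L2.inner_def, ← integral_const_mul]
  refine integral_mono_ae ((L2.integrable_inner f f).const_mul c) (L2.integrable_inner _ f) ?_
  filter_upwards [A.coeFn_compLpL f] with t ht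
  rw [ht]
  change c * inner ℝ (f t) (f t) ≤ _
  rw [real_inner_self_eq_norm_sq]
  exact h _

omit [CompleteSpace E] in
/-- A pointwise upper bound for a quadratic form carries over to `L²(0, T; E)`. -/
theorem inner_compLpL_self_le (A : E →L[ℝ] E) {c : ℝ} (h : ∀ x, inner ℝ (A x) x ≤ c * ‖x‖ ^ 2)
    (f : Lp E 2 (vol 0 T)) :
    inner ℝ (A.compLpL 2 (vol 0 T) f) f ≤ c * ‖f‖ ^ 2 := by
  rw [← real_inner_self_eq_norm_sq, L2.inner_def, L2.inner_def, ← integral_const_mul]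
  refine integral_mono_ae (L2.integrable_inner _ f) ((L2.integrable_inner f f).const_mul c) ?_
  filter_upwards [A.coeFn_compLpL f] with t ht
  rw [ht]
  change _ ≤ c * inner ℝ (f t) (f t)
  rw [real_inner_self_eq_norm_sq]
  exact h _

/-- For symmetric `A`, the form `⟨A ∫₀ᵗ f, f⟩` integrates to `½ ⟨A ∫ f, ∫ f⟩`. -/
theorem inner_compLpL_volterra_self {A : E →L[ℝ] E} (hA : ∀ x y, inner ℝ (A x) y = inner ℝ x (A y))
    (f : Lp E 2 (vol 0 T)) :
    inner ℝ (A.compLpL 2 (vol 0 T) (volterra T E f)) f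
      = 1 / 2 * inner ℝ (A (integralL T E f)) (integralL T E f) := by
  have h := inner_volterra_add_inner_volterra (A.compLpL 2 (vol 0 T) f) f
  rw [integralL_compLpL, volterra_compLpL, inner_compLpL_symm hA f, real_inner_comm _ f] at h
  linarith

end Inner

/-! ### Hilbert space tools: Lions' lemma, solution operators, Tikhonov functionals. -/

section Hilbert

/-- Lions' projection lemma: solvability of `⟨x, A d⟩ = ⟨ξ, S d⟩` for all `d`, with `x` in the closure
of the range of `S`, under a coercivity condition on test elements. -/
theorem exists_of_coercive_pairing {X D : Type*} [NormedAddCommGroup X] [InnerProductSpace ℝ X]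
    [CompleteSpace X] [AddCommGroup D] [Module ℝ D] (S A : D →ₗ[ℝ] X) {c : ℝ} (hc : 0 < c)
    (h : ∀ d, c * ‖S d‖ ^ 2 ≤ inner ℝ (A d) (S d)) (ξ : X) :
    ∃ x ∈ (LinearMap.range S).topologicalClosure, ‖x‖ ≤ c⁻¹ * ‖ξ‖ ∧
      ∀ d, inner ℝ x (A d) = inner ℝ ξ (S d) := by
  set W := (LinearMap.range S).topologicalClosure with hW
  have hWc : IsClosed (W : Set X) := Submodule.isClosed_topologicalClosure _
  have : CompleteSpace W := hWc.completeSpace_coe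
  have hSW : ∀ d, S d ∈ W := fun d =>
    Submodule.le_topologicalClosure _ (LinearMap.mem_range_self S d)
  -- Since S d lies in W, pairing it with A d or with its projection Q d is the same. Coercivity and
  -- Cauchy-Schwarz then bound ‖S d‖ by ‖Q d‖.
  set Q : D →ₗ[ℝ] W := W.orthogonalProjectionOnto.toLinearMap ∘ₗ A with hQ
  have hinner : ∀ (w : W) d, inner ℝ w (Q d) = inner ℝ (w : X) (A d) := fun w d => by
    simp [hQ]
  have hbound : ∀ d, ‖S d‖ ≤ c⁻¹ * ‖Q d‖ := by
    intro d
    have h1 : c * ‖S d‖ ^ 2 ≤ ‖Q d‖ * ‖S d‖ := by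
      refine (h d).trans ?_
      rw [real_inner_comm, ← hinner ⟨S d, hSW d⟩ d, real_inner_comm]
      exact real_inner_le_norm _ _
    rw [inv_mul_eq_div, le_div_iff₀ hc]
    rcases (norm_nonneg (S d)).eq_or_lt with h0 | h0
    · rw [← h0, zero_mul]
      exact norm_nonneg _
    · nlinarith
  have hcongr : ∀ d d', Q d = Q d' → S d = S d' := by
    intro d d' hdd
    have := hbound (d - d')
    rw [map_sub, map_sub, hdd, sub_self, norm_zero, mul_zero] at this
    exact sub_eq_zero.1 (norm_le_zero_iff.1 this)
  -- The functional Q d ↦ ⟨ξ, S d⟩ is well defined and bounded because Q d determines S d.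
  -- Hahn-Banach extends it to W with the same norm, and its Riesz representative is x.
  choose pre hpre using fun q : LinearMap.range Q => q.2
  let f₀ : LinearMap.range Q →ₗ[ℝ] ℝ :=
    { toFun := fun q => inner ℝ ξ (S (pre q))
      map_add' := fun p q => by
        rw [← inner_add_right, ← map_add]
        congr 1
        apply hcongr
        rw [hpre, map_add, hpre, hpre]
        rfl
      map_smul' := fun a q => by
        rw [RingHom.id_apply, smul_eq_mul, ← real_inner_smul_right, ← map_smul]
        congr 1
        apply hcongr
        rw [hpre, map_smul, hpre]
        rfl }
  have hf₀ : ∀ q, ‖f₀ q‖ ≤ c⁻¹ * ‖ξ‖ * ‖q‖ := by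
    intro q
    have h1 : ‖f₀ q‖ ≤ ‖ξ‖ * ‖S (pre q)‖ := norm_inner_le_norm _ _
    have h2 := hbound (pre q)
    rw [hpre] at h2
    calc ‖f₀ q‖ ≤ ‖ξ‖ * ‖S (pre q)‖ := h1
      _ ≤ ‖ξ‖ * (c⁻¹ * ‖q‖) := by gcongr; exact h2
      _ = c⁻¹ * ‖ξ‖ * ‖q‖ := by ring
  obtain ⟨f, hf, hfn⟩ := exists_extension_norm_eq (𝕜 := ℝ) (LinearMap.range Q)
    (f₀.mkContinuous _ hf₀)
  set x : W := (InnerProductSpace.toDual ℝ W).symm f with hx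
  refine ⟨x, x.2, ?_, fun d => ?_⟩
  · change ‖x‖ ≤ _
    rw [hx, LinearIsometryEquiv.norm_map, hfn]
    exact LinearMap.mkContinuous_norm_le _ (by positivity) _
  · rw [← hinner, hx, InnerProductSpace.toDual_symm_apply]
    have h1 := hf ⟨Q d, LinearMap.mem_range_self Q d⟩
    rw [h1]
    change inner ℝ ξ (S _) = _
    rw [hcongr _ d (hpre ⟨Q d, LinearMap.mem_range_self Q d⟩)]

/-- A uniquely solvable linear equation with an a priori bound has a bounded solution operator. -/
theorem exists_solution_operator {X Y Z : Type*} [NormedAddCommGroup X] [NormedSpace ℝ X]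
    [NormedAddCommGroup Y] [NormedSpace ℝ Y] [NormedAddCommGroup Z] [NormedSpace ℝ Z]
    (A : Y →L[ℝ] Z) (B : X →L[ℝ] Z) (hA : ∀ y, A y = 0 → y = 0) (C : ℝ)
    (h : ∀ x, ∃ y, A y = B x ∧ ‖y‖ ≤ C * ‖x‖) : ∃ S : X →L[ℝ] Y, ∀ x, A (S x) = B x := by
  choose s hs hsn using h
  have hinj : ∀ y y', A y = A y' → y = y' := fun y y' hy =>
    sub_eq_zero.1 (hA _ (by rw [map_sub, hy, sub_self]))
  refine ⟨LinearMap.mkContinuous { toFun := s, map_add' := ?_, map_smul' := ?_ } C hsn, hs⟩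
  · intro x x'
    apply hinj
    rw [hs, map_add, map_add, hs, hs]
  · intro a x
    apply hinj
    rw [hs, RingHom.id_apply, map_smul, map_smul, hs]

/-- A Tikhonov functional has a unique minimizer on a nonempty closed convex set. -/
theorem existsUnique_isMinOn_tikhonov {X Y : Type*} [NormedAddCommGroup X] [InnerProductSpace ℝ X]
    [CompleteSpace X] [NormedAddCommGroup Y] [InnerProductSpace ℝ Y] [CompleteSpace Y]
    (S : X →L[ℝ] Y) (b : Y) {α : ℝ} (hα : 0 < α) {K : Set X} (hne : K.Nonempty) (hK : IsClosed K)
    (hconv : Convex ℝ K) :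
    ∃! x, x ∈ K ∧ IsMinOn (fun x => 1 / 2 * ‖S x - b‖ ^ 2 + α / 2 * ‖x‖ ^ 2) K x := by
  set f : X → ℝ := fun x => 1 / 2 * ‖S x - b‖ ^ 2 + α / 2 * ‖x‖ ^ 2 with hf
  have hsα : 0 < √α := Real.sqrt_pos.2 hα
  have hα2 : √α ^ 2 = α := Real.sq_sqrt hα.le
  -- With L x = (S x, √α x) and u = (b, 0), the functional is half the squared distance from u to L
  -- x. The component √α x bounds L from below, so L is injective and the image of K is complete.
  let L : X →L[ℝ] WithLp 2 (Y × X) :=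
    ((WithLp.prodContinuousLinearEquiv 2 ℝ Y X).symm : Y × X →L[ℝ] WithLp 2 (Y × X)).comp
      (S.prod (√α • ContinuousLinearMap.id ℝ X))
  let u : WithLp 2 (Y × X) := WithLp.toLp 2 (b, 0)
  have hLu : ∀ x, ‖u - L x‖ ^ 2 = 2 * f x := by
    intro x
    rw [WithLp.prod_norm_sq_eq_of_L2]
    have h1 : (u - L x).fst = b - S x := rfl
    have h2 : (u - L x).snd = 0 - √α • x := rfl
    rw [h1, h2, zero_sub, norm_neg, norm_smul, mul_pow, Real.norm_eq_abs, sq_abs, hα2,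
      norm_sub_rev, hf]
    ring
  have hanti : AntilipschitzWith (Real.toNNReal (√α)⁻¹) L := by
    refine L.antilipschitz_of_bound fun x => ?_
    rw [Real.coe_toNNReal _ (by positivity), inv_mul_eq_div, le_div_iff₀ hsα]
    have h1 : ‖L x‖ ^ 2 = ‖S x‖ ^ 2 + ‖√α • x‖ ^ 2 := WithLp.prod_norm_sq_eq_of_L2 _
    rw [norm_smul, Real.norm_eq_abs, abs_of_pos hsα] at h1
    refine le_of_sq_le_sq ?_ (norm_nonneg _)
    nlinarith [sq_nonneg ‖S x‖]
  have hcomp : IsComplete (L '' K) := 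
    (isComplete_image_iff (hanti.isUniformInducing L.uniformContinuous)).2 hK.isComplete
  obtain ⟨v, ⟨x, hxK, rfl⟩, hv⟩ := exists_norm_eq_iInf_of_complete_convex (hne.image L) hcomp
    (hconv.is_linear_image L.toLinearMap.isLinear) u
  have hmin : IsMinOn f K x := by
    intro y hy
    have h1 : ‖u - L x‖ ≤ ‖u - L y‖ := by
      rw [hv]
      exact ciInf_le ⟨0, by rintro _ ⟨w, rfl⟩; exact norm_nonneg _⟩
        (⟨L y, mem_image_of_mem L hy⟩ : L '' K)
    have h2 : ‖u - L x‖ ^ 2 ≤ ‖u - L y‖ ^ 2 := by gcongr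
    rw [hLu, hLu] at h2
    change f x ≤ f y
    linarith
  refine ⟨x, ⟨hxK, hmin⟩, ?_⟩
  · rintro y ⟨hyK, hymin⟩
    -- Uniqueness: the parallelogram law at the midpoint of two minimizers forces their images under
    -- L to coincide.
    have hm : (1 / 2 : ℝ) • x + (1 / 2 : ℝ) • y ∈ K :=
      hconv hxK hyK (by norm_num) (by norm_num) (by norm_num)
    have h1 : f y ≤ f ((1 / 2 : ℝ) • x + (1 / 2 : ℝ) • y) := hymin hm
    have h2 : f y ≤ f x := hymin hxK
    have h3 : f x ≤ f y := hmin hyK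
    have h4 := parallelogram_law_with_norm ℝ (u - L x) (u - L y)
    have h5 : (u - L x) + (u - L y) = (2 : ℝ) • (u - L ((1 / 2 : ℝ) • x + (1 / 2 : ℝ) • y)) := by
      rw [map_add, map_smul, map_smul]
      module
    rw [h5, norm_smul, Real.norm_eq_abs, abs_two] at h4
    have h6 := hLu x
    have h7 := hLu y
    have h8 := hLu ((1 / 2 : ℝ) • x + (1 / 2 : ℝ) • y)
    have h9 : ‖u - L x - (u - L y)‖ = 0 := by
      nlinarith [norm_nonneg (u - L x - (u - L y))]
    refine hanti.injective ?_
    rw [norm_eq_zero, sub_sub_sub_cancel_left, sub_eq_zero] at h9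
    exact h9

end Hilbert

/-! ### The abstract second-order evolution equation. -/

section Evolution

variable {T : ℝ} {H : Type*} [NormedAddCommGroup H] [InnerProductSpace ℝ H] [CompleteSpace H]

/-- The operator `(y, z) ↦ (K z - J y, K* ρ y + k z + r J z)` on pairs of `H`-valued functions of time,
with `J` the Volterra operator. -/
def evolutionOp (T : ℝ) (K ρ k r : H →L[ℝ] H) :
    Lp H 2 (vol 0 T) × Lp H 2 (vol 0 T) →L[ℝ] Lp H 2 (vol 0 T) × Lp H 2 (vol 0 T) :=
  ((K.compLpL 2 (vol 0 T)).comp (ContinuousLinearMap.snd ℝ _ _)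
      - (volterra T H).comp (ContinuousLinearMap.fst ℝ _ _)).prod
    (((ContinuousLinearMap.adjoint K).compLpL 2 (vol 0 T)).comp
        ((ρ.compLpL 2 (vol 0 T)).comp (ContinuousLinearMap.fst ℝ _ _))
      + (k.compLpL 2 (vol 0 T)).comp (ContinuousLinearMap.snd ℝ _ _)
      + (r.compLpL 2 (vol 0 T)).comp ((volterra T H).comp (ContinuousLinearMap.snd ℝ _ _)))

theorem evolutionOp_apply (K ρ k r : H →L[ℝ] H) (p : Lp H 2 (vol 0 T) × Lp H 2 (vol 0 T)) :
    evolutionOp T K ρ k r p = (K.compLpL 2 (vol 0 T) p.2 - volterra T H p.1,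
      (ContinuousLinearMap.adjoint K).compLpL 2 (vol 0 T) (ρ.compLpL 2 (vol 0 T) p.1)
        + k.compLpL 2 (vol 0 T) p.2 + r.compLpL 2 (vol 0 T) (volterra T H p.2)) := rfl

theorem inner_volterra_self_nonneg (f : Lp H 2 (vol 0 T)) : 0 ≤ inner ℝ f (volterra T H f) := by
  have h := inner_volterra_add_inner_volterra f f
  rw [real_inner_comm] at h
  have := real_inner_self_nonneg (x := integralL T H f)
  linarith

theorem inner_compLpL_volterra_self_nonneg {A : H →L[ℝ] H}
    (hA : ∀ x y, inner ℝ (A x) y = inner ℝ x (A y)) (hA0 : ∀ x, 0 ≤ inner ℝ (A x) x)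
    (f : Lp H 2 (vol 0 T)) :
    0 ≤ inner ℝ (A.compLpL 2 (vol 0 T) (volterra T H f)) f := by
  rw [inner_compLpL_volterra_self hA]
  have := hA0 (integralL T H f)
  positivity

variable {K ρ k r : H →L[ℝ] H} {ρ₀ κ₀ r₁ : ℝ}

/-- Uniqueness for `κ z + r ∫₀ᵗ z = 0`. -/
theorem eq_zero_of_add_volterra_eq_zero (hκ₀ : 0 < κ₀)
    (hk : ∀ x, κ₀ * ‖x‖ ^ 2 ≤ inner ℝ (k x) x) (hrs : ∀ x y, inner ℝ (r x) y = inner ℝ x (r y))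
    (hr : ∀ x, 0 ≤ inner ℝ (r x) x) {z : Lp H 2 (vol 0 T)}
    (h : inner ℝ (k.compLpL 2 (vol 0 T) z + r.compLpL 2 (vol 0 T) (volterra T H z)) z ≤ 0) :
    z = 0 := by
  rw [inner_add_left] at h
  have h1 := inner_compLpL_self_ge k hk z
  have h2 := inner_compLpL_volterra_self_nonneg hrs hr z
  have h3 : κ₀ * ‖z‖ ^ 2 ≤ 0 := by linarith
  have h4 : ‖z‖ ^ 2 ≤ 0 := nonpos_of_mul_nonpos_right h3 hκ₀
  exact norm_eq_zero.1 (pow_eq_zero_iff two_ne_zero |>.1 (h4.antisymm (sq_nonneg _)))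

/-- Pair the second equation with z. The inertia term is ⟨ρ y, K z⟩ = ⟨ρ y, J y⟩ ≥ 0 by the first
equation, so the damping and stiffness terms force z = 0. Then J y = K z = 0, and J is injective. -/
theorem evolutionOp_injective (hT : 0 < T)
    (hρs : ∀ x y, inner ℝ (ρ x) y = inner ℝ x (ρ y)) (hρ : ∀ x, 0 ≤ inner ℝ (ρ x) x)
    (hκ₀ : 0 < κ₀) (hk : ∀ x, κ₀ * ‖x‖ ^ 2 ≤ inner ℝ (k x) x)
    (hrs : ∀ x y, inner ℝ (r x) y = inner ℝ x (r y)) (hr : ∀ x, 0 ≤ inner ℝ (r x) x)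
    (p : Lp H 2 (vol 0 T) × Lp H 2 (vol 0 T)) (hp : evolutionOp T K ρ k r p = 0) : p = 0 := by
  obtain ⟨y, z⟩ := p
  rw [evolutionOp_apply, Prod.mk_eq_zero] at hp
  obtain ⟨h1, h2⟩ := hp
  rw [sub_eq_zero] at h1
  dsimp only at h1 h2
  have hz : z = 0 := by
    refine eq_zero_of_add_volterra_eq_zero (T := T) hκ₀ hk hrs hr ?_
    have h3 : inner ℝ ((ContinuousLinearMap.adjoint K).compLpL 2 (vol 0 T)
        (ρ.compLpL 2 (vol 0 T) y)) z = inner ℝ (ρ.compLpL 2 (vol 0 T) (volterra T H y)) y := by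
      rw [real_inner_comm, ← inner_compLpL_left, h1, inner_compLpL_symm hρs]
    have h4 := inner_compLpL_volterra_self_nonneg hρs hρ y
    have h5 := congrArg (fun w => inner ℝ w z) h2
    simp only [add_assoc, inner_add_left _ (_ + _), inner_zero_left] at h5
    linarith
  rw [hz, map_zero] at h1
  rw [hz, volterra_injective hT h1.symm]
  rfl

/-- Coercivity of the bilinear form of the evolution problem, with `ζ + m ∫₀ᵗ ζ` as test function. -/
theorem evolution_coercive
    (hρs : ∀ x y, inner ℝ (ρ x) y = inner ℝ x (ρ y)) (hρ₀ : 0 ≤ ρ₀)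
    (hρ : ∀ x, ρ₀ * ‖x‖ ^ 2 ≤ inner ℝ (ρ x) x)
    (hκ₀ : 0 < κ₀) (hks : ∀ x y, inner ℝ (k x) y = inner ℝ x (k y))
    (hk : ∀ x, κ₀ * ‖x‖ ^ 2 ≤ inner ℝ (k x) x)
    (hrs : ∀ x y, inner ℝ (r x) y = inner ℝ x (r y)) (hr : ∀ x, 0 ≤ inner ℝ (r x) x)
    (hr₁ : 0 < r₁) (hr' : ∀ x, inner ℝ (r x) x ≤ r₁ * ‖x‖ ^ 2) (ζ η : Lp H 2 (vol 0 T))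
    (hη : η = ζ + (2 * r₁ / κ₀) • volterra T H ζ) :
    ρ₀ * ‖K.compLpL 2 (vol 0 T) ζ‖ ^ 2 + r₁ * ‖volterra T H ζ‖ ^ 2
        + κ₀ / 4 * ‖integralL T H ζ‖ ^ 2
      ≤ inner ℝ (ρ.compLpL 2 (vol 0 T) (K.compLpL 2 (vol 0 T) η)) (K.compLpL 2 (vol 0 T) ζ)
        + inner ℝ (k.compLpL 2 (vol 0 T) η) (volterra T H ζ)
        + inner ℝ (r.compLpL 2 (vol 0 T) η) (volterra T H (volterra T H ζ)) := by
  -- The value m κ₀ = 2 r₁ makes the damping term of the test function m J ζ absorb the negative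
  -- term -⟨r Z, Z⟩ ≥ -r₁‖Z‖² and still leave r₁‖Z‖².
  set m : ℝ := 2 * r₁ / κ₀ with hm
  have hm0 : 0 < m := by positivity
  have hmκ : m * κ₀ = 2 * r₁ := by rw [hm]; field_simp
  set Z := volterra T H ζ with hZ
  set f := K.compLpL 2 (vol 0 T) ζ with hf
  set ZT := integralL T H ζ with hZT
  set YT := integralL T H Z with hYT
  have a1 := inner_compLpL_self_ge (T := T) ρ hρ f
  have a2 := inner_compLpL_volterra_self_nonneg (T := T) hρs
    (fun x => (by positivity : (0 : ℝ) ≤ ρ₀ * ‖x‖ ^ 2).trans (hρ x)) f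
  have b1 := inner_compLpL_volterra_self (T := T) hks ζ
  rw [inner_compLpL_symm hks, real_inner_comm, ← hZ, ← hZT] at b1
  have b2 := inner_compLpL_self_ge (T := T) k hk Z
  have b3 := hk ZT
  have c1 := inner_volterra_add_inner_volterra (r.compLpL 2 (vol 0 T) Z) ζ
  rw [integralL_compLpL, volterra_compLpL, inner_compLpL_symm hrs, real_inner_comm, ← hZ, ← hZT,
    ← hYT, inner_compLpL_symm hrs, real_inner_comm] at c1
  have c2 := inner_compLpL_volterra_self (T := T) hrs Z
  rw [inner_compLpL_symm hrs, real_inner_comm, ← hYT] at c2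
  have c3 := inner_compLpL_self_le (T := T) r hr' Z
  have d1 := hr (m • YT + ZT)
  have d2 := hr' ZT
  rw [map_add, map_smul, inner_add_left, inner_add_right, inner_add_right, real_inner_smul_left,
    real_inner_smul_right, real_inner_smul_left, real_inner_smul_right, hrs ZT YT,
    real_inner_comm _ ZT] at d1
  have e1 : inner ℝ (ρ.compLpL 2 (vol 0 T) (K.compLpL 2 (vol 0 T) η)) f
      = inner ℝ (ρ.compLpL 2 (vol 0 T) f) f
        + m * inner ℝ (ρ.compLpL 2 (vol 0 T) (volterra T H f)) f := by
    rw [hη, map_add, map_smul, map_add, map_smul, inner_add_left, real_inner_smul_left, hf,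
      volterra_compLpL]
  have e2 : inner ℝ (k.compLpL 2 (vol 0 T) η) Z = inner ℝ (k.compLpL 2 (vol 0 T) ζ) Z
      + m * inner ℝ (k.compLpL 2 (vol 0 T) Z) Z := by
    rw [hη, map_add, map_smul, inner_add_left, real_inner_smul_left]
  have e3 : inner ℝ (r.compLpL 2 (vol 0 T) η) (volterra T H Z)
      = inner ℝ (r.compLpL 2 (vol 0 T) ζ) (volterra T H Z)
      + m * inner ℝ (r.compLpL 2 (vol 0 T) Z) (volterra T H Z) := by
    rw [hη, map_add, map_smul, inner_add_left, real_inner_smul_left]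
  rw [e1, e2, e3]
  have g1 : 0 ≤ m * inner ℝ (ρ.compLpL 2 (vol 0 T) (volterra T H f)) f := mul_nonneg hm0.le a2
  have g2 : 2 * r₁ * ‖Z‖ ^ 2 ≤ m * inner ℝ (k.compLpL 2 (vol 0 T) Z) Z := by
    calc 2 * r₁ * ‖Z‖ ^ 2 = m * (κ₀ * ‖Z‖ ^ 2) := by rw [← hmκ]; ring
      _ ≤ _ := by gcongr
  -- Completing the square with ⟨r (m YT + ZT), m YT + ZT⟩ ≥ 0 costs r₁/(2m) = κ₀/4 of ‖ZT‖², half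
  -- of what ½⟨k ZT, ZT⟩ supplies.
  have g3 : -(κ₀ / 4 * ‖ZT‖ ^ 2) ≤ inner ℝ (r YT) ZT + m / 2 * inner ℝ (r YT) YT := by
    have : 0 ≤ m * (m * inner ℝ (r YT) YT + 2 * inner ℝ (r YT) ZT + κ₀ / 2 * ‖ZT‖ ^ 2) := by
      have : m * (κ₀ / 2 * ‖ZT‖ ^ 2) = r₁ * ‖ZT‖ ^ 2 := by
        linear_combination (‖ZT‖ ^ 2 / 2) * hmκ
      linarith
    have := nonneg_of_mul_nonneg_right this hm0
    linarith
  have x1 : inner ℝ (k.compLpL 2 (vol 0 T) ζ) Z = 1 / 2 * inner ℝ (k ZT) ZT := b1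
  have x2 : inner ℝ (r.compLpL 2 (vol 0 T) ζ) (volterra T H Z)
    = inner ℝ (r YT) ZT - inner ℝ (r.compLpL 2 (vol 0 T) Z) Z := by
    rw [inner_compLpL_symm hrs, real_inner_comm]
    linarith [c1]
  have x3 : inner ℝ (r.compLpL 2 (vol 0 T) Z) (volterra T H Z) = 1 / 2 * inner ℝ (r YT) YT := c2
  rw [x1, x2, x3]
  linarith

/-- The evolution equation is solvable with an a priori bound. -/
theorem exists_evolutionOp_eq
    (hρs : ∀ x y, inner ℝ (ρ x) y = inner ℝ x (ρ y)) (hρ₀ : 0 < ρ₀)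
    (hρ : ∀ x, ρ₀ * ‖x‖ ^ 2 ≤ inner ℝ (ρ x) x)
    (hκ₀ : 0 < κ₀) (hks : ∀ x y, inner ℝ (k x) y = inner ℝ x (k y))
    (hk : ∀ x, κ₀ * ‖x‖ ^ 2 ≤ inner ℝ (k x) x)
    (hrs : ∀ x y, inner ℝ (r x) y = inner ℝ x (r y)) (hr : ∀ x, 0 ≤ inner ℝ (r x) x)
    (hr₁ : 0 < r₁) (hr' : ∀ x, inner ℝ (r x) x ≤ r₁ * ‖x‖ ^ 2) :
    ∃ C : ℝ, ∀ G : Lp H 2 (vol 0 T), ∃ p, evolutionOp T K ρ k r p = (0, volterra T H G) ∧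
      ‖p‖ ≤ C * ‖G‖ := by
  set m : ℝ := 2 * r₁ / κ₀ with hm
  have hm0 : 0 < m := by positivity
  -- The three components stand for u_tt, u_xxt and the final value u_xxt(T). Formally ζ is u_xxtt,
  -- which the estimate does not control; only the triple S ζ = (K ζ, J ζ, ∫ ζ) is controlled.
  let X := WithLp 2 (Lp H 2 (vol 0 T) × WithLp 2 (Lp H 2 (vol 0 T) × H))
  let mkX : Lp H 2 (vol 0 T) × Lp H 2 (vol 0 T) × H →L[ℝ] X :=
    ((WithLp.prodContinuousLinearEquiv 2 ℝ (Lp H 2 (vol 0 T))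
        (WithLp 2 (Lp H 2 (vol 0 T) × H))).symm : _ →L[ℝ] X).comp
      ((ContinuousLinearMap.fst ℝ _ _).prod
        (((WithLp.prodContinuousLinearEquiv 2 ℝ (Lp H 2 (vol 0 T)) H).symm :
          _ →L[ℝ] WithLp 2 (Lp H 2 (vol 0 T) × H)).comp (ContinuousLinearMap.snd ℝ _ _)))
  have hmkX : ∀ (x : X) a b h, inner ℝ x (mkX (a, b, h)) = inner ℝ x.fst a
      + (inner ℝ x.snd.fst b + inner ℝ x.snd.snd h) := fun x a b h => by
    rw [WithLp.prod_inner_apply, WithLp.prod_inner_apply]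
    rfl
  have hmkXn : ∀ a b h, ‖mkX (a, b, h)‖ ^ 2 = ‖a‖ ^ 2 + (‖b‖ ^ 2 + ‖h‖ ^ 2) := fun a b h => by
    rw [WithLp.prod_norm_sq_eq_of_L2]
    congr 1
    exact WithLp.prod_norm_sq_eq_of_L2 _
  let S : Lp H 2 (vol 0 T) →L[ℝ] X := mkX.comp ((K.compLpL 2 (vol 0 T)).prod
    ((volterra T H).prod (integralL T H)))
  let B : Lp H 2 (vol 0 T) →L[ℝ] X := mkX.comp
    (((ρ.compLpL 2 (vol 0 T)).comp (K.compLpL 2 (vol 0 T))).prod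
    ((k.compLpL 2 (vol 0 T)
      + (ContinuousLinearMap.adjoint (volterra T H)).comp (r.compLpL 2 (vol 0 T))).prod 0))
  let A : Lp H 2 (vol 0 T) →L[ℝ] X :=
    B.comp (ContinuousLinearMap.id ℝ _ + m • volterra T H)
  -- Chosen so that ⟨Ξ G, S d⟩ = ⟨J G, d + m J d⟩. Integration by parts moves the derivative from d
  -- to the load, and the boundary term at T pairs with the third component.
  let Ξ : Lp H 2 (vol 0 T) →L[ℝ] X := mkX.comp
    ((0 : Lp H 2 (vol 0 T) →L[ℝ] Lp H 2 (vol 0 T)).prod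
      ((m • volterra T H - ContinuousLinearMap.id ℝ _).prod (integralL T H)))
  have hB : ∀ (x : X) η, inner ℝ x (B η)
      = inner ℝ ((ContinuousLinearMap.adjoint K).compLpL 2 (vol 0 T) (ρ.compLpL 2 (vol 0 T) x.fst)
        + k.compLpL 2 (vol 0 T) x.snd.fst
        + r.compLpL 2 (vol 0 T) (volterra T H x.snd.fst)) η := by
    intro x η
    change inner ℝ x (mkX (ρ.compLpL 2 (vol 0 T) (K.compLpL 2 (vol 0 T) η),
      k.compLpL 2 (vol 0 T) η
        + ContinuousLinearMap.adjoint (volterra T H) (r.compLpL 2 (vol 0 T) η), 0)) = _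
    rw [hmkX, inner_zero_right, add_zero, inner_add_right, inner_add_left, inner_add_left,
      ContinuousLinearMap.adjoint_inner_right, ← inner_compLpL_symm hρs, ← inner_compLpL_symm hks,
      ← inner_compLpL_symm hrs, inner_compLpL_left (ContinuousLinearMap.adjoint K),
      ContinuousLinearMap.adjoint_adjoint, add_assoc]
  set c : ℝ := min ρ₀ (min r₁ (κ₀ / 4)) with hc
  have hc0 : 0 < c := lt_min hρ₀ (lt_min hr₁ (by positivity))
  have hcoer : ∀ ζ, c * ‖S ζ‖ ^ 2 ≤ inner ℝ (A ζ) (S ζ) := by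
    intro ζ
    have h1 := evolution_coercive (K := K) hρs hρ₀.le hρ hκ₀ hks hk hrs hr hr₁ hr' ζ _ rfl
    have h2 : ‖S ζ‖ ^ 2 = ‖K.compLpL 2 (vol 0 T) ζ‖ ^ 2
        + (‖volterra T H ζ‖ ^ 2 + ‖integralL T H ζ‖ ^ 2) := hmkXn _ _ _
    have h3 : inner ℝ (A ζ) (S ζ) = _ := hmkX _ _ _ _
    rw [h3, h2]
    have h4 : ∀ η, inner ℝ (B η).fst (K.compLpL 2 (vol 0 T) ζ)
        + (inner ℝ (B η).snd.fst (volterra T H ζ) + inner ℝ (B η).snd.snd (integralL T H ζ))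
        = inner ℝ (ρ.compLpL 2 (vol 0 T) (K.compLpL 2 (vol 0 T) η)) (K.compLpL 2 (vol 0 T) ζ)
        + inner ℝ (k.compLpL 2 (vol 0 T) η) (volterra T H ζ)
        + inner ℝ (r.compLpL 2 (vol 0 T) η) (volterra T H (volterra T H ζ)) := by
      intro η
      change inner ℝ (ρ.compLpL 2 (vol 0 T) (K.compLpL 2 (vol 0 T) η)) (K.compLpL 2 (vol 0 T) ζ)
        + (inner ℝ (k.compLpL 2 (vol 0 T) η + ContinuousLinearMap.adjoint (volterra T H)
          (r.compLpL 2 (vol 0 T) η)) (volterra T H ζ) + inner ℝ (0 : H) (integralL T H ζ)) = _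
      rw [inner_zero_left, add_zero, inner_add_left, ContinuousLinearMap.adjoint_inner_left,
        add_assoc]
    refine le_trans ?_ (h1.trans_eq (h4 _).symm)
    have l1 : c ≤ ρ₀ := min_le_left _ _
    have l2 : c ≤ r₁ := (min_le_right _ _).trans (min_le_left _ _)
    have l3 : c ≤ κ₀ / 4 := (min_le_right _ _).trans (min_le_right _ _)
    rw [mul_add, mul_add, ← add_assoc]
    gcongr
  refine ⟨c⁻¹ * ‖Ξ‖, fun G => ?_⟩
  obtain ⟨x, hxS, hxn, hx⟩ := exists_of_coercive_pairing S.toLinearMap A.toLinearMap hc0 hcoer (Ξ G)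
  refine ⟨(x.fst, x.snd.fst), ?_, ?_⟩
  · rw [evolutionOp_apply]
    refine Prod.ext ?_ ?_
    -- The relation K z = J y holds on the range of S because K and J commute, and it passes to the
    -- closure, where x lies.
    · let L : X →L[ℝ] Lp H 2 (vol 0 T) :=
        (K.compLpL 2 (vol 0 T)).comp ((WithLp.fstL 2 ℝ _ _).comp (WithLp.sndL 2 ℝ _ _))
          - (volterra T H).comp (WithLp.fstL 2 ℝ _ _)
      have hL : (LinearMap.range S.toLinearMap).topologicalClosure ≤ LinearMap.ker L.toLinearMap := by
        refine Submodule.topologicalClosure_minimal _ ?_ (ContinuousLinearMap.isClosed_ker L)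
        rintro _ ⟨ζ, rfl⟩
        change K.compLpL 2 (vol 0 T) (volterra T H ζ) - volterra T H (K.compLpL 2 (vol 0 T) ζ) = 0
        rw [volterra_compLpL, sub_self]
      exact hL hxS
    · refine sub_eq_zero.1 ?_
      set M := (ContinuousLinearMap.adjoint K).compLpL 2 (vol 0 T) (ρ.compLpL 2 (vol 0 T) x.fst)
        + k.compLpL 2 (vol 0 T) x.snd.fst
        + r.compLpL 2 (vol 0 T) (volterra T H x.snd.fst) with hM
      change M - volterra T H G = 0
      -- The residual itself is used as d: then ‖d‖² + m⟨d, J d⟩ = 0 with both terms nonnegative.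
      set d := M - volterra T H G with hd
      have h1 : inner ℝ x (A d) = inner ℝ M (d + m • volterra T H d) := hB _ _
      have h2 : inner ℝ (Ξ G) (S d) = inner ℝ (volterra T H G) (d + m • volterra T H d) := by
        refine (hmkX _ _ _ _).trans ?_
        change inner ℝ (0 : Lp H 2 (vol 0 T)) _ + (inner ℝ (m • volterra T H G - G) (volterra T H d)
          + inner ℝ (integralL T H G) (integralL T H d)) = _
        rw [← inner_volterra_add_inner_volterra, inner_zero_left, inner_sub_left, inner_add_right,
          real_inner_smul_left, real_inner_smul_right]
        ring
      have h3 : inner ℝ d (d + m • volterra T H d) = 0 := by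
        have h := hx d
        rw [ContinuousLinearMap.coe_coe, ContinuousLinearMap.coe_coe, h1, h2] at h
        rw [show inner ℝ d (d + m • volterra T H d) = inner ℝ (M - volterra T H G)
          (d + m • volterra T H d) from rfl, inner_sub_left, h, sub_self]
      rw [inner_add_right, real_inner_smul_right, real_inner_self_eq_norm_sq] at h3
      have h4 := mul_nonneg hm0.le (inner_volterra_self_nonneg d)
      have h5 : ‖d‖ ^ 2 = 0 := le_antisymm (by linarith) (sq_nonneg _)
      exact norm_eq_zero.1 (pow_eq_zero_iff two_ne_zero |>.1 h5)
  · have h1 : ‖x‖ ≤ c⁻¹ * ‖Ξ‖ * ‖G‖ := by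
      refine hxn.trans ?_
      rw [mul_assoc]
      gcongr
      exact Ξ.le_opNorm G
    have h2 := WithLp.prod_norm_sq_eq_of_L2 x
    have h3 := WithLp.prod_norm_sq_eq_of_L2 x.snd
    refine (norm_prod_le_iff.2 ⟨?_, ?_⟩).trans h1
    · refine le_of_sq_le_sq ?_ (norm_nonneg _)
      nlinarith [sq_nonneg ‖x.snd‖]
    · refine le_of_sq_le_sq ?_ (norm_nonneg _)
      change ‖x.snd.fst‖ ^ 2 ≤ _
      nlinarith [sq_nonneg ‖x.fst‖, sq_nonneg ‖x.snd.snd‖]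

end Evolution

theorem real_inner_eq_product (a b : ℝ) : inner ℝ a b = a * b := mul_comm b a

/-! ### Multiplication by bounded coefficients. -/

section Multiplication

variable {ℓ : ℝ}

/-- Multiplication by a bounded function on `L²(0, ℓ)`. -/
def mulOp (a : Lp ℝ ⊤ (vol 0 ℓ)) : L2 0 ℓ →L[ℝ] L2 0 ℓ :=
  (ContinuousLinearMap.mul ℝ ℝ).holderL (vol 0 ℓ) ⊤ 2 2 a

theorem coeFn_mulOp (a : Lp ℝ ⊤ (vol 0 ℓ)) (f : L2 0 ℓ) :
    mulOp a f =ᵐ[vol 0 ℓ] fun x => a x * f x :=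
  (ContinuousLinearMap.mul ℝ ℝ).coeFn_holder a f

theorem inner_mulOp (a : Lp ℝ ⊤ (vol 0 ℓ)) (f g : L2 0 ℓ) :
    inner ℝ (mulOp a f) g = ∫ x, a x * f x * g x ∂(vol 0 ℓ) := by
  rw [L2.inner_def]
  refine integral_congr_ae ?_
  filter_upwards [coeFn_mulOp a f] with x hx
  rw [hx, real_inner_eq_product]

theorem inner_mulOp_symm (a : Lp ℝ ⊤ (vol 0 ℓ)) (f g : L2 0 ℓ) :
    inner ℝ (mulOp a f) g = inner ℝ f (mulOp a g) := by
  rw [inner_mulOp, real_inner_comm, inner_mulOp]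
  refine integral_congr_ae (Filter.Eventually.of_forall fun x => ?_)
  ring

theorem le_inner_mulOp {a : Lp ℝ ⊤ (vol 0 ℓ)} {c : ℝ} (h : ∀ᵐ x ∂(vol 0 ℓ), c ≤ a x) (f : L2 0 ℓ) :
    c * ‖f‖ ^ 2 ≤ inner ℝ (mulOp a f) f := by
  rw [← real_inner_self_eq_norm_sq, L2.inner_def, L2.inner_def, ← integral_const_mul]
  refine integral_mono_ae ((L2.integrable_inner f f).const_mul c) (L2.integrable_inner _ f) ?_
  filter_upwards [coeFn_mulOp a f, h] with x hx hc
  rw [hx, real_inner_eq_product, real_inner_eq_product]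
  nlinarith [mul_self_nonneg (f x)]

theorem inner_mulOp_le {a : Lp ℝ ⊤ (vol 0 ℓ)} {c : ℝ} (h : ∀ᵐ x ∂(vol 0 ℓ), a x ≤ c) (f : L2 0 ℓ) :
    inner ℝ (mulOp a f) f ≤ c * ‖f‖ ^ 2 := by
  rw [← real_inner_self_eq_norm_sq, L2.inner_def, L2.inner_def, ← integral_const_mul]
  refine integral_mono_ae (L2.integrable_inner _ f) ((L2.integrable_inner f f).const_mul c) ?_
  filter_upwards [coeFn_mulOp a f, h] with x hx hc
  rw [hx, real_inner_eq_product, real_inner_eq_product]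
  nlinarith [mul_self_nonneg (f x)]

/-- The coefficients r and κ come as L² classes; multiplication operators on L² need them as
elements of L^∞. -/
theorem exists_Linfty_ae_eq (f : L2 0 ℓ) {m M : ℝ}
    (h : ∀ᵐ x ∂(vol 0 ℓ), m ≤ f x ∧ f x ≤ M) : ∃ a : Lp ℝ ⊤ (vol 0 ℓ), a =ᵐ[vol 0 ℓ] f := by
  have hf : MemLp f ⊤ (vol 0 ℓ) := memLp_top_of_bound (Lp.aestronglyMeasurable f) (max (-m) M) (by
    filter_upwards [h] with x hx
    rw [Real.norm_eq_abs, abs_le]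
    constructor
    · linarith [hx.1, le_max_left (-m) M]
    · exact hx.2.trans (le_max_right _ _))
  exact ⟨hf.toLp, hf.coeFn_toLp⟩

end Multiplication

/-! ### Continuous functions on [0, ℓ] inside L²(0, ℓ). -/

section ContinuousFunctions

variable {ℓ : ℝ}

/-- The embedding `C[0, ℓ] → L²(0, ℓ)`. -/
def ofCont (hℓ : 0 < ℓ) : C(Icc (0 : ℝ) ℓ, ℝ) →L[ℝ] L2 0 ℓ :=
  LinearMap.mkContinuous
    { toFun := fun f => (memLp_of_continuous (T := ℓ) (f := IccExtend hℓ.le f)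
        (f.continuous.Icc_extend' )).toLp
      map_add' := fun f g => rfl
      map_smul' := fun c f => rfl }
    (measureUnivNNReal (vol 0 ℓ) ^ (2 : ENNReal).toReal⁻¹) fun f => by
      refine Lp.norm_le_of_ae_bound (norm_nonneg f) ?_
      filter_upwards [(memLp_of_continuous (T := ℓ) (f := IccExtend hℓ.le f)
        (f.continuous.Icc_extend')).coeFn_toLp] with t ht
      exact (congrArg norm ht).trans_le (f.norm_coe_le_norm _)

theorem coeFn_ofCont (hℓ : 0 < ℓ) (f : C(Icc (0 : ℝ) ℓ, ℝ)) :
    ofCont hℓ f =ᵐ[vol 0 ℓ] IccExtend hℓ.le f :=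
  (memLp_of_continuous (T := ℓ) (f := IccExtend hℓ.le f) (f.continuous.Icc_extend')).coeFn_toLp

theorem hasValueAt_ofCont (hℓ : 0 < ℓ) (f : C(Icc (0 : ℝ) ℓ, ℝ)) (x : Icc (0 : ℝ) ℓ) :
    HasValueAt 0 ℓ (ofCont hℓ f) x (f x) :=
  ⟨IccExtend hℓ.le f, f.continuous.Icc_extend'.continuousOn, (coeFn_ofCont hℓ f).symm,
    IccExtend_val _ _ _⟩

theorem mulOp_ofCont (hℓ : 0 < ℓ) {a : Lp ℝ ⊤ (vol 0 ℓ)} {b : C(Icc (0 : ℝ) ℓ, ℝ)}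
    (h : a =ᵐ[vol 0 ℓ] ofCont hℓ b) (f : C(Icc (0 : ℝ) ℓ, ℝ)) :
    mulOp a (ofCont hℓ f) = ofCont hℓ (b * f) := by
  refine Lp.ext ?_
  filter_upwards [coeFn_mulOp a (ofCont hℓ f), h, coeFn_ofCont hℓ b, coeFn_ofCont hℓ f,
    coeFn_ofCont hℓ (b * f)] with x h1 h2 h3 h4 h5
  rw [h1, h2, h3, h4, h5]
  rfl

/-- The continuous function `x ↦ ∫ₓˡ f`. -/
def tailInt (ℓ : ℝ) : L2 0 ℓ →L[ℝ] C(Icc (0 : ℝ) ℓ, ℝ) :=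
  LinearMap.mkContinuous
    { toFun := fun f => ⟨fun x => integralL ℓ ℝ f - prim ℓ f x,
        continuous_const.sub ((continuous_prim (integrable_coeFn f)).comp continuous_subtype_val)⟩
      map_add' := fun f g => by
        ext x
        change integralL ℓ ℝ (f + g) - prim ℓ (f + g : L2 0 ℓ) x = (integralL ℓ ℝ f - prim ℓ f x)
          + (integralL ℓ ℝ g - prim ℓ g x)
        rw [map_add, prim_congr_ae (Lp.coeFn_add f g),
          prim_add (integrable_coeFn f) (integrable_coeFn g)]
        ring
      map_smul' := fun c f => by
        ext x
        change integralL ℓ ℝ (c • f) - prim ℓ (c • f : L2 0 ℓ) x = c * (integralL ℓ ℝ f - prim ℓ f x)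
        rw [map_smul, prim_congr_ae (Lp.coeFn_smul c f), prim_smul, smul_eq_mul, smul_eq_mul]
        ring }
    (2 * l1Const ℓ ℝ) fun f => by
      refine (ContinuousMap.norm_le _ (by have := l1Const_nonneg ℓ ℝ; positivity)).2 fun x => ?_
      change ‖integralL ℓ ℝ f - prim ℓ f x‖ ≤ _
      have h1 := (norm_prim_le (integrable_coeFn f) x).trans (integral_norm_le f)
      have h2 : ‖integralL ℓ ℝ f‖ ≤ _ := (norm_integral_le_integral_norm _).trans (integral_norm_le f)
      linarith [norm_sub_le (integralL ℓ ℝ f) (prim ℓ f x)]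

/-- By the integration by parts identity, J* f = ∫ f - J f. So J* gains continuity, which is how the
bending moment acquires point values. -/
theorem ofCont_tailInt (hℓ : 0 < ℓ) (f : L2 0 ℓ) :
    ofCont hℓ (tailInt ℓ f) = ContinuousLinearMap.adjoint (volterra ℓ ℝ) f := by
  have hconst : ∀ (c : ℝ) (g : L2 0 ℓ), inner ℝ (Lp.const 2 (vol 0 ℓ) c) g
      = c * integralL ℓ ℝ g := by
    intro c g
    rw [L2.inner_def, integralL_apply, ← integral_const_mul]
    refine integral_congr_ae ?_
    filter_upwards [Lp.coeFn_const 2 (vol 0 ℓ) c] with x hx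
    rw [hx, real_inner_eq_product]
    rfl
  have h1 : ofCont hℓ (tailInt ℓ f) = Lp.const 2 (vol 0 ℓ) (integralL ℓ ℝ f) - volterra ℓ ℝ f := by
    refine Lp.ext ?_
    filter_upwards [coeFn_ofCont hℓ (tailInt ℓ f), coeFn_volterra f,
      Lp.coeFn_sub (Lp.const 2 (vol 0 ℓ) (integralL ℓ ℝ f)) (volterra ℓ ℝ f),
      Lp.coeFn_const 2 (vol 0 ℓ) (integralL ℓ ℝ f), ae_restrict_mem measurableSet_Ioo]
      with x h1 h2 h3 h4 h5
    rw [h1, h3, Pi.sub_apply, h2, h4, IccExtend_of_mem _ _ (Ioo_subset_Icc_self h5)]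
    rfl
  refine ext_inner_right ℝ fun g => ?_
  rw [ContinuousLinearMap.adjoint_inner_left, h1, inner_sub_left, hconst]
  have h2 := inner_volterra_add_inner_volterra f g
  rw [real_inner_eq_product] at h2
  linarith

theorem exists_ofCont_eq (hℓ : 0 < ℓ) {f f' : L2 0 ℓ} (h : IsWeakDeriv 0 ℓ f f') :
    ∃ b : C(Icc (0 : ℝ) ℓ, ℝ), ofCont hℓ b = f := by
  obtain ⟨c, hc⟩ := h.exists_ae_eq_add_prim hℓ (integrable_coeFn f) (integrable_coeFn f')
  refine ⟨⟨fun x => c + prim ℓ f' x, continuous_const.add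
    ((continuous_prim (integrable_coeFn f')).comp continuous_subtype_val)⟩, Lp.ext ?_⟩
  filter_upwards [coeFn_ofCont hℓ ⟨fun x => c + prim ℓ f' x, continuous_const.add
    ((continuous_prim (integrable_coeFn f')).comp continuous_subtype_val)⟩, hc,
    ae_restrict_mem measurableSet_Ioo] with x h1 h2 h3
  rw [h1, h2, IccExtend_of_mem _ _ (Ioo_subset_Icc_self h3)]
  rfl

/-- Taking the maximum with m does not change the class and makes the lower bound hold everywhere.
For κ this gives invertibility in C[0, ℓ]. -/
theorem exists_ofCont_eq_of_ge (hℓ : 0 < ℓ) {f f' : L2 0 ℓ} (h : IsWeakDeriv 0 ℓ f f') {m : ℝ}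
    (hm : ∀ᵐ x ∂(vol 0 ℓ), m ≤ f x) :
    ∃ b : C(Icc (0 : ℝ) ℓ, ℝ), ofCont hℓ b = f ∧ ∀ x, m ≤ b x := by
  obtain ⟨b, hb⟩ := exists_ofCont_eq hℓ h
  refine ⟨b ⊔ ContinuousMap.const _ m, ?_, fun x => le_sup_right⟩
  refine Lp.ext ?_
  have hb' := coeFn_ofCont hℓ b
  rw [hb] at hb'
  filter_upwards [coeFn_ofCont hℓ (b ⊔ ContinuousMap.const _ m), hb', hm] with x h1 h2 h3
  rw [h1, h2]
  rw [h2] at h3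
  exact sup_eq_left.2 h3

end ContinuousFunctions

/-! ### The space `V ℓ` parametrized by the second derivative. -/

section SpaceV

variable {ℓ : ℝ}

theorem V.D_one_eq (hℓ : 0 < ℓ) (v : V ℓ) : V.D 1 v = volterra ℓ ℝ (V.D 2 v) :=
  IsWeakDeriv.eq_volterra hℓ (v.2.1 1) v.2.2.2

theorem V.D_zero_eq (hℓ : 0 < ℓ) (v : V ℓ) :
    V.D 0 v = volterra ℓ ℝ (volterra ℓ ℝ (V.D 2 v)) := by
  rw [← V.D_one_eq hℓ]
  exact IsWeakDeriv.eq_volterra hℓ (v.2.1 0) v.2.2.1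

/-- `v ↦ ∂ₓⁱ v` as a bounded operator. -/
def V.DL (ℓ : ℝ) (i : Fin 3) : V ℓ →L[ℝ] L2 0 ℓ :=
  (PiLp.proj 2 (fun _ : Fin 3 => L2 0 ℓ) i).comp (V ℓ).subtypeL

/-- The element of `V ℓ` with a given second derivative. -/
def V.ofSecondDeriv (hℓ : 0 < ℓ) : L2 0 ℓ →L[ℝ] V ℓ :=
  ContinuousLinearMap.codRestrict
    (((PiLp.continuousLinearEquiv 2 ℝ (fun _ : Fin 3 => L2 0 ℓ)).symm : _ →L[ℝ] Jet 0 ℓ 2).comp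
      (ContinuousLinearMap.pi ![(volterra ℓ ℝ).comp (volterra ℓ ℝ), volterra ℓ ℝ,
        ContinuousLinearMap.id ℝ _])) (V ℓ) fun w => by
    refine ⟨?_, hasValueAt_volterra_zero _, hasValueAt_volterra_zero _⟩
    intro i
    fin_cases i
    · exact isWeakDeriv_volterra hℓ (volterra ℓ ℝ w)
    · exact isWeakDeriv_volterra hℓ w

theorem V.D_two_ofSecondDeriv (hℓ : 0 < ℓ) (w : L2 0 ℓ) :
    V.D 2 (V.ofSecondDeriv hℓ w) = w := rfl

theorem V.ofSecondDeriv_D_two (hℓ : 0 < ℓ) (v : V ℓ) :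
    V.ofSecondDeriv hℓ (V.D 2 v) = v := by
  refine Subtype.ext (PiLp.ext fun i => ?_)
  fin_cases i
  · exact (V.D_zero_eq hℓ v).symm
  · exact (V.D_one_eq hℓ v).symm
  · rfl

/-- The function `x ↦ ℓ - x`, which represents `v ↦ v(ℓ)` through the second derivative. -/
def endFun (ℓ : ℝ) : C(Icc (0 : ℝ) ℓ, ℝ) := tailInt ℓ (Lp.const 2 (vol 0 ℓ) 1)

/-- Since ℓ - x = J* 1, the pairing is ⟨1, J w⟩. For w = v_xx this is ∫ v_x = v(ℓ). -/
theorem inner_endFun (hℓ : 0 < ℓ) (w : L2 0 ℓ) :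
    inner ℝ (ofCont hℓ (endFun ℓ)) w = integralL ℓ ℝ (volterra ℓ ℝ w) := by
  rw [endFun, ofCont_tailInt, ContinuousLinearMap.adjoint_inner_left, L2.inner_def, integralL_apply]
  refine integral_congr_ae ?_
  filter_upwards [Lp.coeFn_const 2 (vol 0 ℓ) (1 : ℝ)] with x hx
  rw [hx, real_inner_eq_product]
  exact one_mul _

theorem V.hasValueAt_right (hℓ : 0 < ℓ) (v : V ℓ) :
    HasValueAt 0 ℓ (V.D 0 v) ℓ (inner ℝ (ofCont hℓ (endFun ℓ)) (V.D 2 v)) := by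
  rw [V.D_zero_eq hℓ, inner_endFun]
  exact hasValueAt_volterra_right _

end SpaceV

/-! ### A linear Volterra equation in a commutative Banach algebra. -/

section VolterraEquation

variable {T : ℝ} {A : Type*} [NormedCommRing A] [NormedAlgebra ℝ A] [CompleteSpace A]

/-- The equation `p + q ∫₀ᵗ p = N` is solvable in `L²(0, T; A)` for a commutative Banach algebra `A`
and `q ∈ A`. -/
theorem exists_add_mul_volterra_eq (q : A) (N : Lp A 2 (vol 0 T)) :
    ∃ p : Lp A 2 (vol 0 T),
      p + (ContinuousLinearMap.mul ℝ A q).compLpL 2 (vol 0 T) (volterra T A p) = N := by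
  set P : ℝ → A := prim T N with hP
  have hPc : Continuous P := continuous_prim (integrable_coeFn N)
  set X : ℝ → A := fun t => NormedSpace.exp (t • q) with hX
  have hXd : ∀ t, HasDerivAt X (X t * q) t := fun t => hasDerivAt_exp_smul_const q t
  have hXc : Continuous X := continuous_iff_continuousAt.2 fun t => (hXd t).continuousAt
  set Y : ℝ → A := fun t => NormedSpace.exp (t • (-q)) with hY
  have hYd : ∀ t, HasDerivAt Y (Y t * (-q)) t := fun t => hasDerivAt_exp_smul_const (-q) t
  have hYc : Continuous Y := continuous_iff_continuousAt.2 fun t => (hYd t).continuousAt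
  have hXY : ∀ t, Y t * X t = 1 := by
    intro t
    rw [hX, hY]
    dsimp only
    let : NormedAlgebra ℚ A := NormedAlgebra.restrictScalars ℚ ℝ A
    rw [← NormedSpace.exp_add]
    simp
  set R : ℝ → A := fun t => ∫ τ in (0 : ℝ)..t, X τ * (q * P τ) with hR
  have hXP : Continuous fun τ => X τ * (q * P τ) := hXc.mul (continuous_const.mul hPc)
  have hRd : ∀ t, HasDerivAt R (X t * (q * P t)) t := fun t =>
    intervalIntegral.integral_hasDerivAt_right (hXP.intervalIntegrable _ _)
      (hXP.stronglyMeasurableAtFilter _ _) hXP.continuousAt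
  -- With the ansatz p = N + s', s(0) = 0, one has J p = P + s, so the equation becomes s' = -q s -
  -- q P. Variation of constants gives s(t) = -e^{-tq} ∫₀ᵗ e^{τq} q P(τ) dτ.
  set s : ℝ → A := fun t => -(Y t * R t) with hs
  have hsd : ∀ t, HasDerivAt s (-(q * s t) - q * P t) t := by
    intro t
    have h : HasDerivAt s _ t := ((hYd t).mul (hRd t)).neg
    refine h.congr_deriv ?_
    rw [hs]
    dsimp only
    linear_combination (-(q * P t)) * hXY t
  have hsc : Continuous s := continuous_iff_continuousAt.2 fun t => (hsd t).continuousAt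
  set s' : ℝ → A := fun t => -(q * s t) - q * P t with hs'
  have hs'c : Continuous s' := (continuous_const.mul hsc).neg.sub (continuous_const.mul hPc)
  have hs0 : s 0 = 0 := by simp [hs, hR]
  have hm : MemLp s' 2 (vol 0 T) := memLp_of_continuous hs'c
  refine ⟨N + hm.toLp, Lp.ext ?_⟩
  filter_upwards [Lp.coeFn_add (N + hm.toLp) ((ContinuousLinearMap.mul ℝ A q).compLpL 2 (vol 0 T)
      (volterra T A (N + hm.toLp))), Lp.coeFn_add N hm.toLp, hm.coeFn_toLp,
    (ContinuousLinearMap.mul ℝ A q).coeFn_compLpL (volterra T A (N + hm.toLp)),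
    coeFn_volterra (N + hm.toLp), ae_restrict_mem measurableSet_Ioo] with t h1 h2 h3 h4 h5 h6
  rw [h1, Pi.add_apply, h2, Pi.add_apply, h3, h4, h5, prim_congr_ae (Lp.coeFn_add N hm.toLp),
    prim_add (integrable_coeFn N) (integrable_coeFn _), prim_congr_ae hm.coeFn_toLp,
    prim_eq_of_hasDerivAt hsd hs'c (Ioo_subset_Icc_self h6), hs0, sub_zero,
    ContinuousLinearMap.mul_apply']
  rw [hs']
  ring

end VolterraEquation

/-! ### Stability of point values. -/

section HasValueAt

variable {a b c : ℝ} {E F : Type*} [TopologicalSpace E] [TopologicalSpace F]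

theorem HasValueAt.congr {f g : ℝ → E} {y : E} (h : HasValueAt a b f c y) (hfg : f =ᵐ[vol a b] g) :
    HasValueAt a b g c y := by
  obtain ⟨f₀, h1, h2, h3⟩ := h
  exact ⟨f₀, h1, h2.trans hfg, h3⟩

theorem HasValueAt.comp {f : ℝ → E} {y : E} (h : HasValueAt a b f c y) {A : E → F}
    (hA : Continuous A) : HasValueAt a b (fun t => A (f t)) c (A y) := by
  obtain ⟨f₀, h1, h2, h3⟩ := h
  refine ⟨fun t => A (f₀ t), hA.comp_continuousOn h1, ?_, congrArg A h3⟩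
  filter_upwards [h2] with t ht
  rw [ht]

end HasValueAt

/-! ### Weak solutions as solutions of the operator equation. -/

section WeakSolution

variable {ℓ T : ℝ}

/-- The twofold primitive, which recovers `v ∈ V ℓ` from its second derivative. -/
def doublePrim (ℓ : ℝ) : L2 0 ℓ →L[ℝ] L2 0 ℓ := (volterra ℓ ℝ).comp (volterra ℓ ℝ)

/-- The operator through which `u_xxt` enters the variational equation. -/
def dampingOp (μ κ : Lp ℝ ⊤ (vol 0 ℓ)) : L2 0 ℓ →L[ℝ] L2 0 ℓ :=
  mulOp κ + (ContinuousLinearMap.adjoint (doublePrim ℓ)).comp ((mulOp μ).comp (doublePrim ℓ))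

theorem V.D_zero_eq_doublePrim (hℓ : 0 < ℓ) (v : V ℓ) : V.D 0 v = doublePrim ℓ (V.D 2 v) :=
  V.D_zero_eq hℓ v

/-- The load `t ↦ g(t) (ℓ - x)`. -/
def loadOp (hℓ : 0 < ℓ) : ℝ →L[ℝ] L2 0 ℓ :=
  ContinuousLinearMap.toSpanSingleton ℝ (ofCont hℓ (endFun ℓ))

theorem variational_form (hℓ : 0 < ℓ) {ρ μ r κ : Lp ℝ ⊤ (vol 0 ℓ)} (y w z : L2 0 ℓ) (v : V ℓ) :
    (∫ x, ρ x * y x * V.D 0 v x ∂(vol 0 ℓ)) + (∫ x, μ x * doublePrim ℓ z x * V.D 0 v x ∂(vol 0 ℓ))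
      + (∫ x, r x * w x * V.D 2 v x ∂(vol 0 ℓ)) + (∫ x, κ x * z x * V.D 2 v x ∂(vol 0 ℓ))
    = inner ℝ (ContinuousLinearMap.adjoint (doublePrim ℓ) (mulOp ρ y) + dampingOp μ κ z
        + mulOp r w) (V.D 2 v) := by
  rw [← inner_mulOp, ← inner_mulOp, ← inner_mulOp, ← inner_mulOp, V.D_zero_eq_doublePrim hℓ,
    inner_add_left, inner_add_left, ContinuousLinearMap.adjoint_inner_left, dampingOp,
    add_apply, inner_add_left, ContinuousLinearMap.comp_apply,
    ContinuousLinearMap.adjoint_inner_left, ContinuousLinearMap.comp_apply]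
  ring

/-- As v runs through `V ℓ`, its second derivative runs through all of L²(0, ℓ). Moving every term
onto v_xx by adjoints turns the variational equation into an identity in L²(0, ℓ). -/
theorem equation_iff (hℓ : 0 < ℓ) {ρ μ r κ : Lp ℝ ⊤ (vol 0 ℓ)} (y w z : L2 0 ℓ) (c : ℝ) :
    (∀ v : V ℓ, (∫ x, ρ x * y x * V.D 0 v x ∂(vol 0 ℓ))
        + (∫ x, μ x * doublePrim ℓ z x * V.D 0 v x ∂(vol 0 ℓ))
        + (∫ x, r x * w x * V.D 2 v x ∂(vol 0 ℓ)) + (∫ x, κ x * z x * V.D 2 v x ∂(vol 0 ℓ))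
        = c * valueAt 0 ℓ (V.D 0 v) ℓ)
      ↔ ContinuousLinearMap.adjoint (doublePrim ℓ) (mulOp ρ y) + dampingOp μ κ z + mulOp r w
        = loadOp hℓ c := by
  have hval : ∀ v : V ℓ, c * valueAt 0 ℓ (V.D 0 v) ℓ = inner ℝ (loadOp hℓ c) (V.D 2 v) := by
    intro v
    rw [(V.hasValueAt_right hℓ v).valueAt_eq hℓ ⟨hℓ.le, le_rfl⟩, loadOp,
      ContinuousLinearMap.toSpanSingleton_apply, real_inner_smul_left]
  simp only [variational_form hℓ, hval]
  refine ⟨fun h => ext_inner_right ℝ fun w' => ?_, fun h v => by rw [h]⟩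
  exact h (V.ofSecondDeriv hℓ w')

theorem evolutionOp_eq_iff {K ρ k r : L2 0 ℓ →L[ℝ] L2 0 ℓ} {y z f : L2Time T (L2 0 ℓ)} :
    (ContinuousLinearMap.adjoint K).compLpL 2 (vol 0 T) (ρ.compLpL 2 (vol 0 T) y)
        + k.compLpL 2 (vol 0 T) z + r.compLpL 2 (vol 0 T) (volterra T (L2 0 ℓ) z) = f ↔
    ∀ᵐ t ∂(vol 0 T), ContinuousLinearMap.adjoint K (ρ (y t)) + k (z t)
      + r (volterra T (L2 0 ℓ) z t) = f t := by
  have key : ((ContinuousLinearMap.adjoint K).compLpL 2 (vol 0 T) (ρ.compLpL 2 (vol 0 T) y)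
        + k.compLpL 2 (vol 0 T) z + r.compLpL 2 (vol 0 T) (volterra T (L2 0 ℓ) z) : L2Time T (L2 0 ℓ))
      =ᵐ[vol 0 T] fun t => ContinuousLinearMap.adjoint K (ρ (y t)) + k (z t)
      + r (volterra T (L2 0 ℓ) z t) := by
    refine (Lp.coeFn_add _ _).trans ?_
    filter_upwards [Lp.coeFn_add ((ContinuousLinearMap.adjoint K).compLpL 2 (vol 0 T)
        (ρ.compLpL 2 (vol 0 T) y)) (k.compLpL 2 (vol 0 T) z),
      (ContinuousLinearMap.adjoint K).coeFn_compLpL (ρ.compLpL 2 (vol 0 T) y), ρ.coeFn_compLpL y,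
      k.coeFn_compLpL z, r.coeFn_compLpL (volterra T (L2 0 ℓ) z)] with t h1 h2 h3 h4 h5
    rw [Pi.add_apply, h1, Pi.add_apply, h2, h3, h4, h5]
  constructor
  · rintro rfl
    filter_upwards [key] with t ht
    exact ht.symm
  · exact fun h => Lp.ext (key.trans h)

variable {ρ μ rb κb : Lp ℝ ⊤ (vol 0 ℓ)} {r κ : Sobolev 0 ℓ 2}

/-- A weak solution satisfies the evolution equation for `(u_tt, u_xxt)`. -/
theorem IsWeakSolution.evolutionOp_eq (hℓ : 0 < ℓ) (hT : 0 < T)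
    (hr : rb =ᵐ[vol 0 ℓ] Sobolev.D 0 r) (hκ : κb =ᵐ[vol 0 ℓ] Sobolev.D 0 κ) {g : L2 0 T}
    {u ut : L2Time T (V ℓ)} {utt : L2Time T (L2 0 ℓ)} (h : IsWeakSolution ρ μ r κ g u ut utt) :
    ∃ z : L2Time T (L2 0 ℓ),
      evolutionOp T (doublePrim ℓ) (mulOp ρ) (dampingOp μ κb) (mulOp rb) (utt, z)
        = (0, (loadOp hℓ).compLpL 2 (vol 0 T) g) ∧
      u = (V.ofSecondDeriv hℓ).compLpL 2 (vol 0 T) (volterra T (L2 0 ℓ) z) ∧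
      ut = (V.ofSecondDeriv hℓ).compLpL 2 (vol 0 T) z := by
  set z := (V.DL ℓ 2).compLpL 2 (vol 0 T) ut with hz
  set w := (V.DL ℓ 2).compLpL 2 (vol 0 T) u with hw
  have hzt : z =ᵐ[vol 0 T] fun t => V.D 2 (ut t) := (V.DL ℓ 2).coeFn_compLpL ut
  have hwt : w =ᵐ[vol 0 T] fun t => V.D 2 (u t) := (V.DL ℓ 2).coeFn_compLpL u
  have hwz : w = volterra T (L2 0 ℓ) z := by
    refine IsWeakDeriv.eq_volterra hT ?_ ?_
    · exact (h.weakDeriv_u.comp (PiLp.proj 2 (fun _ : Fin 3 => L2 0 ℓ) 2)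
        ((V ℓ).subtypeL.integrable_comp (integrable_coeFn u))
        ((V ℓ).subtypeL.integrable_comp (integrable_coeFn ut))).congr hwt.symm hzt.symm
    · have := h.init_u.comp (V.DL ℓ 2).continuous
      rw [map_zero] at this
      exact this.congr hwt.symm
  -- Both sides are u_t: in space it is the double primitive of u_xxt, in time the primitive of
  -- u_tt.
  have hKz : (doublePrim ℓ).compLpL 2 (vol 0 T) z = volterra T (L2 0 ℓ) utt := by
    have hae : (doublePrim ℓ).compLpL 2 (vol 0 T) z =ᵐ[vol 0 T] fun t => V.D 0 (ut t) := by
      filter_upwards [(doublePrim ℓ).coeFn_compLpL z, hzt] with t h1 h2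
      rw [h1, h2, V.D_zero_eq_doublePrim hℓ]
    refine IsWeakDeriv.eq_volterra hT ?_ ?_
    · exact h.weakDeriv_ut.congr hae.symm Filter.EventuallyEq.rfl
    · exact h.init_ut.congr hae.symm
  refine ⟨z, ?_, ?_, ?_⟩
  · rw [evolutionOp_apply]
    refine Prod.ext (sub_eq_zero.2 hKz) (evolutionOp_eq_iff.2 ?_)
    filter_upwards [h.equation, hzt, hwt, (loadOp hℓ).coeFn_compLpL g] with t h1 h2 h3 h4
    rw [h4, ← hwz, h3, h2, ← equation_iff hℓ]
    intro v
    rw [← h1 v]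
    congr 1
    · congr 1
      · congr 1
        rw [V.D_zero_eq_doublePrim hℓ (ut t)]
      · refine integral_congr_ae ?_
        filter_upwards [hr] with x hx
        rw [hx]
    · refine integral_congr_ae ?_
      filter_upwards [hκ] with x hx
      rw [hx]
  · refine Lp.ext ?_
    filter_upwards [(V.ofSecondDeriv hℓ).coeFn_compLpL (volterra T (L2 0 ℓ) z), hwt] with t h1 h2
    rw [h1, ← hwz, h2, V.ofSecondDeriv_D_two hℓ]
  · refine Lp.ext ?_
    filter_upwards [(V.ofSecondDeriv hℓ).coeFn_compLpL z, hzt] with t h1 h2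
    rw [h1, h2, V.ofSecondDeriv_D_two hℓ]

/-- A solution of the evolution equation yields a weak solution. -/
theorem isWeakSolution_of_evolutionOp_eq (hℓ : 0 < ℓ) (hT : 0 < T)
    (hr : rb =ᵐ[vol 0 ℓ] Sobolev.D 0 r) (hκ : κb =ᵐ[vol 0 ℓ] Sobolev.D 0 κ) {g : L2 0 T}
    {y z : L2Time T (L2 0 ℓ)}
    (h : evolutionOp T (doublePrim ℓ) (mulOp ρ) (dampingOp μ κb) (mulOp rb) (y, z)
      = (0, (loadOp hℓ).compLpL 2 (vol 0 T) g)) :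
    IsWeakSolution ρ μ r κ g ((V.ofSecondDeriv hℓ).compLpL 2 (vol 0 T) (volterra T (L2 0 ℓ) z))
      ((V.ofSecondDeriv hℓ).compLpL 2 (vol 0 T) z) y := by
  rw [evolutionOp_apply, Prod.mk.injEq, sub_eq_zero, evolutionOp_eq_iff] at h
  obtain ⟨h1, h2⟩ := h
  dsimp only at h1 h2
  have hut := (V.ofSecondDeriv hℓ).coeFn_compLpL (μ := vol 0 T) (p := 2) z
  have hu := (V.ofSecondDeriv hℓ).coeFn_compLpL (μ := vol 0 T) (p := 2) (volterra T (L2 0 ℓ) z)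
  have hKz : volterra T (L2 0 ℓ) y =ᵐ[vol 0 T]
      fun t => V.D 0 ((V.ofSecondDeriv hℓ).compLpL 2 (vol 0 T) z t) := by
    rw [← h1]
    filter_upwards [(doublePrim ℓ).coeFn_compLpL z, hut] with t h3 h4
    rw [h3, h4]
    rfl
  refine ⟨?_, ?_, ?_, ?_, ?_⟩
  · refine ((isWeakDeriv_volterra hT z).comp ((V ℓ).subtypeL.comp (V.ofSecondDeriv hℓ))
      (integrable_coeFn _) (integrable_coeFn _)).congr ?_ ?_
    · filter_upwards [hu] with t ht
      rw [ht]
      rfl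
    · filter_upwards [hut] with t ht
      rw [ht]
      rfl
  · exact (isWeakDeriv_volterra hT y).congr hKz Filter.EventuallyEq.rfl
  · filter_upwards [h2, hut, hu, (loadOp hℓ).coeFn_compLpL g] with t h3 h4 h5 h6
    rw [h6, ← equation_iff hℓ] at h3
    intro v
    rw [← h3 v, h4, h5, V.D_two_ofSecondDeriv, V.D_two_ofSecondDeriv]
    congr 1
    · congr 1
      refine integral_congr_ae ?_
      filter_upwards [hr] with x hx
      rw [hx]
    · refine integral_congr_ae ?_
      filter_upwards [hκ] with x hx
      rw [hx]
  · have := (hasValueAt_volterra_zero z).comp (V.ofSecondDeriv hℓ).continuous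
    rw [map_zero] at this
    exact this.congr hu.symm
  · exact (hasValueAt_volterra_zero y).congr hKz

end WeakSolution

/-! ### The beam: solution operator, regularity in space, boundary measurements. -/

section Beam

variable {ℓ T : ℝ} {ρ μ rb κb : Lp ℝ ⊤ (vol 0 ℓ)} {ρ₀ κ₀ r₁ : ℝ}

theorem inner_dampingOp_symm (f g : L2 0 ℓ) :
    inner ℝ (dampingOp μ κb f) g = inner ℝ f (dampingOp μ κb g) := by
  simp only [dampingOp, add_apply, ContinuousLinearMap.comp_apply, inner_add_left, inner_add_right,
    ContinuousLinearMap.adjoint_inner_left, ContinuousLinearMap.adjoint_inner_right,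
    inner_mulOp_symm]

theorem le_inner_dampingOp (hμ : ∀ᵐ x ∂(vol 0 ℓ), 0 ≤ μ x) (hκ : ∀ᵐ x ∂(vol 0 ℓ), κ₀ ≤ κb x)
    (f : L2 0 ℓ) : κ₀ * ‖f‖ ^ 2 ≤ inner ℝ (dampingOp μ κb f) f := by
  simp only [dampingOp, add_apply, ContinuousLinearMap.comp_apply, inner_add_left,
    ContinuousLinearMap.adjoint_inner_left]
  have h1 := le_inner_mulOp hμ (doublePrim ℓ f)
  have h2 := le_inner_mulOp hκ f
  linarith

theorem inner_mulOp_nonneg {a : Lp ℝ ⊤ (vol 0 ℓ)} (h : ∀ᵐ x ∂(vol 0 ℓ), 0 ≤ a x) (f : L2 0 ℓ) :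
    0 ≤ inner ℝ (mulOp a f) f := by
  simpa using le_inner_mulOp h f

theorem beam_injective (hT : 0 < T) (hρ : ∀ᵐ x ∂(vol 0 ℓ), 0 ≤ ρ x)
    (hμ : ∀ᵐ x ∂(vol 0 ℓ), 0 ≤ μ x) (hr : ∀ᵐ x ∂(vol 0 ℓ), 0 ≤ rb x)
    (hκ₀ : 0 < κ₀) (hκ : ∀ᵐ x ∂(vol 0 ℓ), κ₀ ≤ κb x)
    (p : L2Time T (L2 0 ℓ) × L2Time T (L2 0 ℓ))
    (hp : evolutionOp T (doublePrim ℓ) (mulOp ρ) (dampingOp μ κb) (mulOp rb) p = 0) : p = 0 :=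
  evolutionOp_injective hT (inner_mulOp_symm ρ) (inner_mulOp_nonneg hρ) hκ₀
    (le_inner_dampingOp hμ hκ) (inner_mulOp_symm rb) (inner_mulOp_nonneg hr) p hp

/-- The bounded operator `g' ↦ (u_tt, u_xxt)`. -/
theorem exists_beam_solution_operator (hℓ : 0 < ℓ) (hT : 0 < T) (hρ₀ : 0 < ρ₀)
    (hρ : ∀ᵐ x ∂(vol 0 ℓ), ρ₀ ≤ ρ x) (hμ : ∀ᵐ x ∂(vol 0 ℓ), 0 ≤ μ x)
    (hr : ∀ᵐ x ∂(vol 0 ℓ), 0 ≤ rb x) (hr₁ : 0 < r₁) (hr' : ∀ᵐ x ∂(vol 0 ℓ), rb x ≤ r₁)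
    (hκ₀ : 0 < κ₀) (hκ : ∀ᵐ x ∂(vol 0 ℓ), κ₀ ≤ κb x) :
    ∃ S : L2 0 T →L[ℝ] L2Time T (L2 0 ℓ) × L2Time T (L2 0 ℓ), ∀ h,
      evolutionOp T (doublePrim ℓ) (mulOp ρ) (dampingOp μ κb) (mulOp rb) (S h)
        = (0, (loadOp hℓ).compLpL 2 (vol 0 T) (volterra T ℝ h)) := by
  obtain ⟨C, hC⟩ := exists_evolutionOp_eq (T := T) (K := doublePrim ℓ) (inner_mulOp_symm ρ) hρ₀
    (le_inner_mulOp hρ) hκ₀ inner_dampingOp_symm (le_inner_dampingOp hμ hκ) (inner_mulOp_symm rb)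
    (inner_mulOp_nonneg hr) hr₁ (inner_mulOp_le hr')
  refine exists_solution_operator (evolutionOp T (doublePrim ℓ) (mulOp ρ) (dampingOp μ κb)
      (mulOp rb))
    ((0 : L2 0 T →L[ℝ] L2Time T (L2 0 ℓ)).prod
      (((loadOp hℓ).compLpL 2 (vol 0 T)).comp (volterra T ℝ)))
    (beam_injective hT (hρ.mono fun x hx => hρ₀.le.trans hx) hμ hr hκ₀ hκ)
    -- The constant C carries no sign information, so it is replaced by a nonnegative one before
    -- multiplying bounds.
    (max C 0 * ‖(loadOp hℓ).compLpL 2 (vol 0 T)‖) fun h => ?_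
  obtain ⟨p, hp, hpn⟩ := hC ((loadOp hℓ).compLpL 2 (vol 0 T) h)
  refine ⟨p, ?_, hpn.trans ?_⟩
  · rw [hp, volterra_compLpL]
    rfl
  · rw [mul_assoc]
    refine mul_le_mul (le_max_left _ _) (ContinuousLinearMap.le_opNorm _ _) (norm_nonneg _)
      (le_max_right _ _)

/-- The bending moment `r u_xx + κ u_xxt`, as a continuous function of `x`, computed from
`g`, `u_tt` and `u_xxt`. -/
def momentFun (ρ μ : Lp ℝ ⊤ (vol 0 ℓ)) (c : ℝ) (y z : L2 0 ℓ) : C(Icc (0 : ℝ) ℓ, ℝ) :=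
  c • endFun ℓ - tailInt ℓ (ContinuousLinearMap.adjoint (volterra ℓ ℝ)
    (mulOp ρ y + mulOp μ (doublePrim ℓ z)))

/-- The right side is what the equation leaves for κ u_xxt + r u_xx once inertia and viscous damping
are moved over. It is continuous because K* is J* applied twice. -/
theorem ofCont_momentFun (hℓ : 0 < ℓ) (c : ℝ) (y z : L2 0 ℓ) :
    ofCont hℓ (momentFun ρ μ c y z) = loadOp hℓ c
      - ContinuousLinearMap.adjoint (doublePrim ℓ) (mulOp ρ y + mulOp μ (doublePrim ℓ z)) := by
  rw [momentFun, map_sub, map_smul, ofCont_tailInt]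
  simp only [doublePrim, ContinuousLinearMap.adjoint_comp]
  rfl

/-- The trace of the bending moment at the left end, as a bounded operator in time. -/
def leftMoment (T : ℝ) (hℓ : 0 < ℓ) (ρ μ : Lp ℝ ⊤ (vol 0 ℓ)) :
    L2 0 T × (L2Time T (L2 0 ℓ) × L2Time T (L2 0 ℓ)) →L[ℝ] L2 0 T :=
  let tr : L2 0 ℓ →L[ℝ] ℝ := (ContinuousMap.evalCLM ℝ (⟨0, le_rfl, hℓ.le⟩ : Icc (0 : ℝ) ℓ)).comp
    ((tailInt ℓ).comp (ContinuousLinearMap.adjoint (volterra ℓ ℝ)))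
  (((tr.comp (mulOp ρ)).compLpL 2 (vol 0 T)).comp (ContinuousLinearMap.fst ℝ _ _)
    + ((tr.comp ((mulOp μ).comp (doublePrim ℓ))).compLpL 2 (vol 0 T)).comp
      (ContinuousLinearMap.snd ℝ _ _)).comp (ContinuousLinearMap.snd ℝ _ _)
  - endFun ℓ ⟨0, le_rfl, hℓ.le⟩ • ContinuousLinearMap.fst ℝ _ _

theorem coeFn_leftMoment (hℓ : 0 < ℓ) (g : L2 0 T)
    (p : L2Time T (L2 0 ℓ) × L2Time T (L2 0 ℓ)) :
    leftMoment T hℓ ρ μ (g, p) =ᵐ[vol 0 T]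
      fun t => -momentFun ρ μ (g t) (p.1 t) (p.2 t) ⟨0, le_rfl, hℓ.le⟩ := by
  set tr : L2 0 ℓ →L[ℝ] ℝ := (ContinuousMap.evalCLM ℝ (⟨0, le_rfl, hℓ.le⟩ : Icc (0 : ℝ) ℓ)).comp
    ((tailInt ℓ).comp (ContinuousLinearMap.adjoint (volterra ℓ ℝ))) with htr
  have h0 : leftMoment T hℓ ρ μ (g, p) = (tr.comp (mulOp ρ)).compLpL 2 (vol 0 T) p.1
    + (tr.comp ((mulOp μ).comp (doublePrim ℓ))).compLpL 2 (vol 0 T) p.2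
    - endFun ℓ ⟨0, le_rfl, hℓ.le⟩ • g := rfl
  rw [h0]
  filter_upwards [Lp.coeFn_sub ((tr.comp (mulOp ρ)).compLpL 2 (vol 0 T) p.1
    + (tr.comp ((mulOp μ).comp (doublePrim ℓ))).compLpL 2 (vol 0 T) p.2)
      (endFun ℓ ⟨0, le_rfl, hℓ.le⟩ • g),
    Lp.coeFn_add ((tr.comp (mulOp ρ)).compLpL 2 (vol 0 T) p.1)
      ((tr.comp ((mulOp μ).comp (doublePrim ℓ))).compLpL 2 (vol 0 T) p.2),
    (tr.comp (mulOp ρ)).coeFn_compLpL p.1,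
    (tr.comp ((mulOp μ).comp (doublePrim ℓ))).coeFn_compLpL p.2,
    Lp.coeFn_smul (endFun ℓ ⟨0, le_rfl, hℓ.le⟩) g] with t h1 h2 h3 h4 h5
  rw [h1, Pi.sub_apply, h2, Pi.add_apply, h3, h4, h5, Pi.smul_apply, smul_eq_mul]
  have h6 : momentFun ρ μ (g t) (p.1 t) (p.2 t) ⟨0, le_rfl, hℓ.le⟩
      = g t * endFun ℓ ⟨0, le_rfl, hℓ.le⟩ - tr (mulOp ρ (p.1 t) + mulOp μ (doublePrim ℓ (p.2 t))) :=
    rfl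
  rw [h6, map_add]
  simp only [ContinuousLinearMap.comp_apply]
  ring

/-- Spatial regularity: `u_xxt` takes values in `C[0, ℓ]`. -/
theorem exists_continuous_of_evolutionOp_eq (hℓ : 0 < ℓ) (hr : ∀ᵐ x ∂(vol 0 ℓ), 0 ≤ rb x)
    (hκ₀ : 0 < κ₀) (hκ : ∀ᵐ x ∂(vol 0 ℓ), κ₀ ≤ κb x) {rc κc : C(Icc (0 : ℝ) ℓ, ℝ)}
    (hrc : rb =ᵐ[vol 0 ℓ] ofCont hℓ rc) (hκc : κb =ᵐ[vol 0 ℓ] ofCont hℓ κc)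
    (hκc₀ : ∀ x, κ₀ ≤ κc x) {g : L2 0 T} {p : L2Time T (L2 0 ℓ) × L2Time T (L2 0 ℓ)}
    (hp : evolutionOp T (doublePrim ℓ) (mulOp ρ) (dampingOp μ κb) (mulOp rb) p
      = (0, (loadOp hℓ).compLpL 2 (vol 0 T) g)) :
    ∃ zc : Lp C(Icc (0 : ℝ) ℓ, ℝ) 2 (vol 0 T), p.2 = (ofCont hℓ).compLpL 2 (vol 0 T) zc ∧
      ∀ᵐ t ∂(vol 0 T), κc * zc t + rc * volterra T C(Icc (0 : ℝ) ℓ, ℝ) zc t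
        = momentFun ρ μ (g t) (p.1 t) (p.2 t) := by
  obtain ⟨y, z⟩ := p
  rw [evolutionOp_apply, Prod.mk.injEq, evolutionOp_eq_iff] at hp
  obtain ⟨-, h2⟩ := hp
  dsimp only at h2 ⊢
  let κi : C(Icc (0 : ℝ) ℓ, ℝ) :=
    ⟨fun x => (κc x)⁻¹, κc.continuous.inv₀ fun x => (hκ₀.trans_le (hκc₀ x)).ne'⟩
  have hκi : κc * κi = 1 := by
    ext x
    exact mul_inv_cancel₀ (hκ₀.trans_le (hκc₀ x)).ne'
  let ev : C(Icc (0 : ℝ) ℓ, ℝ) →L[ℝ] C(Icc (0 : ℝ) ℓ, ℝ) := ContinuousLinearMap.mul ℝ _ κi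
  let tl : L2 0 ℓ →L[ℝ] C(Icc (0 : ℝ) ℓ, ℝ) :=
    (tailInt ℓ).comp (ContinuousLinearMap.adjoint (volterra ℓ ℝ))
  set M : Lp C(Icc (0 : ℝ) ℓ, ℝ) 2 (vol 0 T) :=
    (ContinuousLinearMap.toSpanSingleton ℝ (endFun ℓ)).compLpL 2 (vol 0 T) g
      - ((tl.comp (mulOp ρ)).compLpL 2 (vol 0 T) y
        + (tl.comp ((mulOp μ).comp (doublePrim ℓ))).compLpL 2 (vol 0 T) z) with hM
  have hMt : ∀ᵐ t ∂(vol 0 T), M t = momentFun ρ μ (g t) (y t) (z t) := by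
    filter_upwards [Lp.coeFn_sub
        ((ContinuousLinearMap.toSpanSingleton ℝ (endFun ℓ)).compLpL 2 (vol 0 T) g)
        ((tl.comp (mulOp ρ)).compLpL 2 (vol 0 T) y
          + (tl.comp ((mulOp μ).comp (doublePrim ℓ))).compLpL 2 (vol 0 T) z),
      Lp.coeFn_add ((tl.comp (mulOp ρ)).compLpL 2 (vol 0 T) y)
        ((tl.comp ((mulOp μ).comp (doublePrim ℓ))).compLpL 2 (vol 0 T) z),
      (ContinuousLinearMap.toSpanSingleton ℝ (endFun ℓ)).coeFn_compLpL g,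
      (tl.comp (mulOp ρ)).coeFn_compLpL y,
      (tl.comp ((mulOp μ).comp (doublePrim ℓ))).coeFn_compLpL z] with t h3 h4 h5 h6 h7
    rw [h3, Pi.sub_apply, h4, Pi.add_apply, h5, h6, h7, momentFun, map_add, map_add]
    rfl
  -- Dividing the moment identity by κ gives zc + (r/κ) J zc = M/κ, which is solved with values in
  -- C[0, ℓ].
  obtain ⟨zc, hzc⟩ := exists_add_mul_volterra_eq (κi * rc) (ev.compLpL 2 (vol 0 T) M)
  have hzct : ∀ᵐ t ∂(vol 0 T), κc * zc t + rc * volterra T C(Icc (0 : ℝ) ℓ, ℝ) zc t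
      = momentFun ρ μ (g t) (y t) (z t) := by
    have h3 := Lp.coeFn_add zc ((ContinuousLinearMap.mul ℝ _ (κi * rc)).compLpL 2 (vol 0 T)
      (volterra T C(Icc (0 : ℝ) ℓ, ℝ) zc))
    rw [hzc] at h3
    filter_upwards [h3, hMt, ev.coeFn_compLpL M, (ContinuousLinearMap.mul ℝ _ (κi * rc)).coeFn_compLpL
      (volterra T C(Icc (0 : ℝ) ℓ, ℝ) zc)] with t h4 h5 h6 h7
    rw [h6, Pi.add_apply, h7, h5] at h4
    change κi * _ = zc t + κi * rc * _ at h4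
    linear_combination (momentFun ρ μ (g t) (y t) (z t)
      - rc * volterra T C(Icc (0 : ℝ) ℓ, ℝ) zc t) * hκi - κc * h4
  refine ⟨zc, ?_, hzct⟩
  set z' := (ofCont hℓ).compLpL 2 (vol 0 T) zc with hz'
  have hJz' : volterra T (L2 0 ℓ) z' = (ofCont hℓ).compLpL 2 (vol 0 T) (volterra T _ zc) :=
    volterra_compLpL _ _
  -- The given z and the continuous solution satisfy the same Volterra equation in L²(0, ℓ), where
  -- solutions are unique.
  have hd : (mulOp κb).compLpL 2 (vol 0 T) (z - z')
      + (mulOp rb).compLpL 2 (vol 0 T) (volterra T (L2 0 ℓ) (z - z')) = 0 := by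
    refine Lp.ext ?_
    filter_upwards [Lp.coeFn_add ((mulOp κb).compLpL 2 (vol 0 T) (z - z'))
        ((mulOp rb).compLpL 2 (vol 0 T) (volterra T (L2 0 ℓ) (z - z'))),
      (mulOp κb).coeFn_compLpL (z - z'), (mulOp rb).coeFn_compLpL (volterra T (L2 0 ℓ) (z - z')),
      Lp.coeFn_zero (L2 0 ℓ) 2 (vol 0 T), Lp.coeFn_sub z z',
      Lp.coeFn_sub (volterra T (L2 0 ℓ) z) (volterra T (L2 0 ℓ) z'), h2, hzct,
      (ofCont hℓ).coeFn_compLpL zc, (ofCont hℓ).coeFn_compLpL (volterra T _ zc),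
      (loadOp hℓ).coeFn_compLpL g] with t h3 h4 h5 h6 h7 h8 h9 h10 h11 h12 h13
    rw [h3, Pi.add_apply, h4, h5, h6, h7, map_sub (volterra T (L2 0 ℓ)), h8, Pi.sub_apply,
      Pi.sub_apply, map_sub, map_sub, hJz', h11, h12, mulOp_ofCont hℓ hκc, mulOp_ofCont hℓ hrc,
      Pi.zero_apply, sub_add_sub_comm, ← map_add, h10, ofCont_momentFun, ← h13, ← h9, dampingOp,
      map_add (ContinuousLinearMap.adjoint (doublePrim ℓ))]
    simp only [add_apply, ContinuousLinearMap.comp_apply]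
    abel
  refine sub_eq_zero.1 (eq_zero_of_add_volterra_eq_zero (k := mulOp κb) (r := mulOp rb) hκ₀
    (le_inner_mulOp hκ) (inner_mulOp_symm rb) (inner_mulOp_nonneg hr) ?_)
  rw [hd, inner_zero_left]

variable {r κ : Sobolev 0 ℓ 2}

/-- Identifies the deflection with a bounded linear image of the unique solution p. This gives
existence and uniqueness of the value and the linearity needed for minimization. -/
theorem isDeflection_iff (hℓ : 0 < ℓ) (hT : 0 < T)
    (hinj : ∀ p, evolutionOp T (doublePrim ℓ) (mulOp ρ) (dampingOp μ κb) (mulOp rb) p = 0 → p = 0)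
    (hr : rb =ᵐ[vol 0 ℓ] Sobolev.D 0 r) (hκ : κb =ᵐ[vol 0 ℓ] Sobolev.D 0 κ) {g : L2 0 T}
    {p : L2Time T (L2 0 ℓ) × L2Time T (L2 0 ℓ)}
    (hp : evolutionOp T (doublePrim ℓ) (mulOp ρ) (dampingOp μ κb) (mulOp rb) p
      = (0, (loadOp hℓ).compLpL 2 (vol 0 T) g)) (y : L2 0 T) :
    IsDeflection ρ μ r κ g y ↔
      y = (innerSL ℝ (ofCont hℓ (endFun ℓ))).compLpL 2 (vol 0 T) (volterra T (L2 0 ℓ) p.2) := by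
  have hval : ∀ᵐ t ∂(vol 0 T), HasValueAt 0 ℓ
      (V.D 0 ((V.ofSecondDeriv hℓ).compLpL 2 (vol 0 T) (volterra T (L2 0 ℓ) p.2) t)) ℓ
      ((innerSL ℝ (ofCont hℓ (endFun ℓ))).compLpL 2 (vol 0 T) (volterra T (L2 0 ℓ) p.2) t) := by
    filter_upwards [(V.ofSecondDeriv hℓ).coeFn_compLpL (volterra T (L2 0 ℓ) p.2),
      (innerSL ℝ (ofCont hℓ (endFun ℓ))).coeFn_compLpL (volterra T (L2 0 ℓ) p.2)] with t h1 h2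
    rw [h1, h2]
    exact V.hasValueAt_right hℓ _
  constructor
  · rintro ⟨u, ut, utt, hw, hy⟩
    obtain ⟨z, hz, rfl, rfl⟩ := hw.evolutionOp_eq hℓ hT hr hκ
    obtain rfl : (utt, z) = p := sub_eq_zero.1 (hinj _ (by rw [map_sub, hz, hp, sub_self]))
    refine Lp.ext ?_
    filter_upwards [hval, hy] with t h1 h2
    exact h2.unique hℓ ⟨hℓ.le, le_rfl⟩ h1
  · rintro rfl
    exact ⟨_, _, _, isWeakSolution_of_evolutionOp_eq hℓ hT hr hκ hp, hval⟩

/-- The continuous versions of u_xx and u_xxt from the C[0, ℓ]-valued equation supply the point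
values. Evaluating the moment identity at x = 0 combines them into `leftMoment`. -/
theorem isMoment_iff (hℓ : 0 < ℓ) (hT : 0 < T)
    (hinj : ∀ p, evolutionOp T (doublePrim ℓ) (mulOp ρ) (dampingOp μ κb) (mulOp rb) p = 0 → p = 0)
    (hr₀ : ∀ᵐ x ∂(vol 0 ℓ), 0 ≤ rb x) (hκ₀ : 0 < κ₀) (hκ₀' : ∀ᵐ x ∂(vol 0 ℓ), κ₀ ≤ κb x)
    (hr : rb =ᵐ[vol 0 ℓ] Sobolev.D 0 r) (hκ : κb =ᵐ[vol 0 ℓ] Sobolev.D 0 κ) {g : L2 0 T}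
    {p : L2Time T (L2 0 ℓ) × L2Time T (L2 0 ℓ)}
    (hp : evolutionOp T (doublePrim ℓ) (mulOp ρ) (dampingOp μ κb) (mulOp rb) p
      = (0, (loadOp hℓ).compLpL 2 (vol 0 T) g)) (y : L2 0 T) :
    IsMoment ρ μ r κ g y ↔ y = leftMoment T hℓ ρ μ (g, p) := by
  obtain ⟨rc, hrc⟩ := exists_ofCont_eq hℓ (r.2 0)
  obtain ⟨κc, hκc, hκc₀⟩ := exists_ofCont_eq_of_ge hℓ (κ.2 0) (m := κ₀) (by
    filter_upwards [hκ₀', hκ] with x h1 h2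
    rw [h2] at h1
    exact h1)
  have hrv : valueAt 0 ℓ (Sobolev.D 0 r) 0 = rc ⟨0, le_rfl, hℓ.le⟩ := by
    refine HasValueAt.valueAt_eq hℓ ⟨le_rfl, hℓ.le⟩ ?_
    have := hasValueAt_ofCont hℓ rc ⟨0, le_rfl, hℓ.le⟩
    rwa [hrc] at this
  have hκv : valueAt 0 ℓ (Sobolev.D 0 κ) 0 = κc ⟨0, le_rfl, hℓ.le⟩ := by
    refine HasValueAt.valueAt_eq hℓ ⟨le_rfl, hℓ.le⟩ ?_
    have := hasValueAt_ofCont hℓ κc ⟨0, le_rfl, hℓ.le⟩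
    rwa [hκc] at this
  obtain ⟨zc, hzc, hzct⟩ := exists_continuous_of_evolutionOp_eq hℓ hr₀ hκ₀ hκ₀'
    (rc := rc) (κc := κc) (by rw [hrc]; exact hr) (by rw [hκc]; exact hκ) hκc₀ hp
  have hwc : volterra T (L2 0 ℓ) p.2 = (ofCont hℓ).compLpL 2 (vol 0 T) (volterra T _ zc) := by
    rw [hzc, volterra_compLpL]
  have hval : ∀ᵐ t ∂(vol 0 T), ∃ a b : ℝ,
      HasValueAt 0 ℓ (V.D 2 ((V.ofSecondDeriv hℓ).compLpL 2 (vol 0 T)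
        (volterra T (L2 0 ℓ) p.2) t)) 0 a ∧
      HasValueAt 0 ℓ (V.D 2 ((V.ofSecondDeriv hℓ).compLpL 2 (vol 0 T) p.2 t)) 0 b ∧
      leftMoment T hℓ ρ μ (g, p) t
        = -(valueAt 0 ℓ (Sobolev.D 0 r) 0 * a + valueAt 0 ℓ (Sobolev.D 0 κ) 0 * b) := by
    filter_upwards [(V.ofSecondDeriv hℓ).coeFn_compLpL (volterra T (L2 0 ℓ) p.2),
      (V.ofSecondDeriv hℓ).coeFn_compLpL p.2, (ofCont hℓ).coeFn_compLpL zc,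
      (ofCont hℓ).coeFn_compLpL (volterra T _ zc), hzct, coeFn_leftMoment (ρ := ρ) (μ := μ) hℓ g p]
      with t h1 h2 h3 h4 h5 h6
    refine ⟨volterra T C(Icc (0 : ℝ) ℓ, ℝ) zc t ⟨0, le_rfl, hℓ.le⟩, zc t ⟨0, le_rfl, hℓ.le⟩,
      ?_, ?_, ?_⟩
    · rw [h1, V.D_two_ofSecondDeriv, hwc, h4]
      exact hasValueAt_ofCont hℓ _ ⟨0, le_rfl, hℓ.le⟩
    · rw [h2, V.D_two_ofSecondDeriv, hzc, h3]
      exact hasValueAt_ofCont hℓ _ ⟨0, le_rfl, hℓ.le⟩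
    · rw [h6, ← h5, hrv, hκv, ContinuousMap.add_apply, ContinuousMap.mul_apply,
        ContinuousMap.mul_apply, add_comm]
  constructor
  · rintro ⟨u, ut, utt, hw, hy⟩
    obtain ⟨z, hz, rfl, rfl⟩ := hw.evolutionOp_eq hℓ hT hr hκ
    obtain rfl : (utt, z) = p := sub_eq_zero.1 (hinj _ (by rw [map_sub, hz, hp, sub_self]))
    refine Lp.ext ?_
    filter_upwards [hval, hy] with t h1 h2
    obtain ⟨a, b, ha, hb, hab⟩ := h1
    obtain ⟨a', b', ha', hb', hab'⟩ := h2
    rw [hab, hab', ha.unique hℓ ⟨le_rfl, hℓ.le⟩ ha', hb.unique hℓ ⟨le_rfl, hℓ.le⟩ hb']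
  · rintro rfl
    exact ⟨_, _, _, isWeakSolution_of_evolutionOp_eq hℓ hT hr hκ hp, hval⟩

end Beam

/-! ### Admissible controls parametrized by their highest derivative. -/

section Controls

variable {T : ℝ}

/-- The element of `H¹(0, T)` with initial value `0` and given derivative. -/
def ofDeriv (T : ℝ) : L2 0 T →L[ℝ] Jet 0 T 1 :=
  ((PiLp.continuousLinearEquiv 2 ℝ (fun _ : Fin 2 => L2 0 T)).symm : _ →L[ℝ] Jet 0 T 1).comp
    (ContinuousLinearMap.pi ![volterra T ℝ, ContinuousLinearMap.id ℝ _])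

/-- The element of `H³(0, T)` with vanishing initial values and given third derivative. -/
def ofThirdDeriv (T : ℝ) : L2 0 T →L[ℝ] Jet 0 T 3 :=
  ((PiLp.continuousLinearEquiv 2 ℝ (fun _ : Fin 4 => L2 0 T)).symm : _ →L[ℝ] Jet 0 T 3).comp
    (ContinuousLinearMap.pi ![(volterra T ℝ).comp ((volterra T ℝ).comp (volterra T ℝ)),
      (volterra T ℝ).comp (volterra T ℝ), volterra T ℝ, ContinuousLinearMap.id ℝ _])

theorem ofDeriv_mem (hT : 0 < T) (h : L2 0 T) : ofDeriv T h ∈ Sobolev 0 T 1 := by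
  intro i
  fin_cases i
  exact isWeakDeriv_volterra hT h

theorem ofThirdDeriv_mem (hT : 0 < T) (h : L2 0 T) : ofThirdDeriv T h ∈ Sobolev 0 T 3 := by
  intro i
  fin_cases i
  · exact isWeakDeriv_volterra hT (volterra T ℝ (volterra T ℝ h))
  · exact isWeakDeriv_volterra hT (volterra T ℝ h)
  · exact isWeakDeriv_volterra hT h

theorem Sobolev.D_eq_volterra (hT : 0 < T) {m : ℕ} (g : Sobolev 0 T m) (i : Fin m)
    (h0 : HasValueAt 0 T (Sobolev.D i.castSucc g) 0 0) :
    Sobolev.D i.castSucc g = volterra T ℝ (Sobolev.D i.succ g) :=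
  IsWeakDeriv.eq_volterra hT (g.2 i) h0

theorem ofDeriv_D_one (hT : 0 < T) {g : Sobolev 0 T 1}
    (h0 : HasValueAt 0 T (Sobolev.D 0 g) 0 0) : ofDeriv T (Sobolev.D 1 g) = g := by
  refine PiLp.ext fun i => ?_
  fin_cases i
  · exact (Sobolev.D_eq_volterra hT g 0 h0).symm
  · rfl

theorem ofThirdDeriv_D_three (hT : 0 < T) {g : Sobolev 0 T 3}
    (h0 : HasValueAt 0 T (Sobolev.D 0 g) 0 0) (h1 : HasValueAt 0 T (Sobolev.D 1 g) 0 0)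
    (h2 : HasValueAt 0 T (Sobolev.D 2 g) 0 0) : ofThirdDeriv T (Sobolev.D 3 g) = g := by
  have e2 : Sobolev.D 2 g = volterra T ℝ (Sobolev.D 3 g) := Sobolev.D_eq_volterra hT g 2 h2
  have e1 : Sobolev.D 1 g = volterra T ℝ (Sobolev.D 2 g) := Sobolev.D_eq_volterra hT g 1 h1
  have e0 : Sobolev.D 0 g = volterra T ℝ (Sobolev.D 1 g) := Sobolev.D_eq_volterra hT g 0 h0
  refine PiLp.ext fun i => ?_
  fin_cases i
  · change volterra T ℝ (volterra T ℝ (volterra T ℝ (Sobolev.D 3 g))) = Sobolev.D 0 g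
    rw [e0, e1, e2]
  · change volterra T ℝ (volterra T ℝ (Sobolev.D 3 g)) = Sobolev.D 1 g
    rw [e1, e2]
  · exact e2.symm
  · rfl

/-- Transfer of a unique minimizer along a parametrization of the admissible set. -/
theorem existsUnique_isMinOn_of_param {X Y : Type*} {K : Set X} {G : Set Y} {f : X → ℝ} {J : Y → ℝ}
    (P : X → Y) (D : Y → X) (hPK : ∀ x ∈ K, P x ∈ G) (hDG : ∀ y ∈ G, D y ∈ K)
    (hPD : ∀ y ∈ G, P (D y) = y) (hJ : ∀ x ∈ K, J (P x) = f x)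
    (h : ∃! x, x ∈ K ∧ IsMinOn f K x) : ∃! y, y ∈ G ∧ IsMinOn J G y := by
  have hJ' : ∀ y ∈ G, J y = f (D y) := fun y hy => by rw [← hJ _ (hDG y hy), hPD y hy]
  obtain ⟨x, ⟨hx, hmin⟩, huniq⟩ := h
  refine ⟨P x, ⟨hPK x hx, fun y hy => ?_⟩, ?_⟩
  · change J (P x) ≤ J y
    rw [hJ x hx, hJ' y hy]
    exact hmin (hDG y hy)
  · rintro y ⟨hy, hymin⟩
    rw [← hPD y hy, huniq (D y) ⟨hDG y hy, fun x' hx' => ?_⟩]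
    change f (D y) ≤ f x'
    rw [← hJ' y hy, ← hJ x' hx']
    exact hymin (hPK x' hx')

/-- Here P rebuilds the control from its highest derivative, so the Sobolev norm bound is the
preimage of a closed ball: closed, convex and containing 0. -/
theorem existsUnique_isMinOn_tikhonov_of_norm_le {X Y Z : Type*} [NormedAddCommGroup X]
    [InnerProductSpace ℝ X] [CompleteSpace X] [NormedAddCommGroup Y] [InnerProductSpace ℝ Y]
    [CompleteSpace Y] [NormedAddCommGroup Z] [NormedSpace ℝ Z]
    (S : X →L[ℝ] Y) (b : Y) {α : ℝ} (hα : 0 < α) (P : X →L[ℝ] Z) {C : ℝ} (hC : 0 ≤ C) :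
    ∃! x, x ∈ {x | ‖P x‖ ≤ C} ∧
      IsMinOn (fun x => 1 / 2 * ‖S x - b‖ ^ 2 + α / 2 * ‖x‖ ^ 2) {x | ‖P x‖ ≤ C} x := by
  have hK : {x | ‖P x‖ ≤ C} = P ⁻¹' Metric.closedBall 0 C := by
    ext x
    simp
  rw [hK]
  refine existsUnique_isMinOn_tikhonov S b hα ⟨0, ?_⟩ (Metric.isClosed_closedBall.preimage
    P.continuous) ((convex_closedBall 0 C).is_linear_preimage P.toLinearMap.isLinear)
  simpa using hC

end Controls

theorem Phi_eq {ℓ T : ℝ} {ρ μ : Lp ℝ ⊤ (vol 0 ℓ)} {r κ : Sobolev 0 ℓ 2}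
    {g y : L2 0 T} (h : ∀ y', IsDeflection ρ μ r κ g y' ↔ y' = y) : Phi ρ μ r κ g = y := by
  have hex : ∃ y, IsDeflection ρ μ r κ g y := ⟨y, (h y).2 rfl⟩
  rw [Phi, dif_pos hex]
  exact (h _).1 hex.choose_spec

theorem Psi_eq {ℓ T : ℝ} {ρ μ : Lp ℝ ⊤ (vol 0 ℓ)} {r κ : Sobolev 0 ℓ 2}
    {g y : L2 0 T} (h : ∀ y', IsMoment ρ μ r κ g y' ↔ y' = y) : Psi ρ μ r κ g = y := by
  have hex : ∃ y, IsMoment ρ μ r κ g y := ⟨y, (h y).2 rfl⟩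
  rw [Psi, dif_pos hex]
  exact (h _).1 hex.choose_spec

end

end KelvinVoigtBeam

/-! ### The main theorem. -/

theorem corollary3p1 (ℓ T : ℝ) (hℓ : 0 < ℓ) (hT : 0 < T)
    (ρ μ : MeasureTheory.Lp ℝ ⊤ (KelvinVoigtBeam.vol 0 ℓ))
    (r κ : KelvinVoigtBeam.Sobolev 0 ℓ 2)
    (ρ₀ ρ₁ μ₀ μ₁ r₀ r₁ κ₀ κ₁ : ℝ)
    (hρ₀ : 0 < ρ₀) (hρ : ∀ᵐ x ∂(KelvinVoigtBeam.vol 0 ℓ), ρ₀ ≤ ρ x ∧ ρ x ≤ ρ₁)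
    (hμ₀ : 0 ≤ μ₀) (hμ : ∀ᵐ x ∂(KelvinVoigtBeam.vol 0 ℓ), μ₀ ≤ μ x ∧ μ x ≤ μ₁)
    (hr₀ : 0 < r₀) (hr : ∀ᵐ x ∂(KelvinVoigtBeam.vol 0 ℓ),
      r₀ ≤ KelvinVoigtBeam.Sobolev.D 0 r x ∧ KelvinVoigtBeam.Sobolev.D 0 r x ≤ r₁)
    (hκ₀ : 0 < κ₀) (hκ : ∀ᵐ x ∂(KelvinVoigtBeam.vol 0 ℓ),
      κ₀ ≤ KelvinVoigtBeam.Sobolev.D 0 κ x ∧ KelvinVoigtBeam.Sobolev.D 0 κ x ≤ κ₁)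
    (Cg Cg' : ℝ) (hCg : 0 < Cg) (hCg' : 0 < Cg')
    (ν ω : KelvinVoigtBeam.L2 0 T) (α : ℝ) (hα : 0 < α) :
    -- the direct problem is uniquely solvable for every shear force `g ∈ H¹(0, T)`, `g(0) = 0`
    (∀ g : KelvinVoigtBeam.Sobolev 0 T 1,
      KelvinVoigtBeam.HasValueAt 0 T (KelvinVoigtBeam.Sobolev.D 0 g) 0 0 →
      ∃! u : KelvinVoigtBeam.L2Time T (KelvinVoigtBeam.V ℓ), ∃ ut utt,
        KelvinVoigtBeam.IsWeakSolution ρ μ r κ (KelvinVoigtBeam.Sobolev.D 0 g) u ut utt) ∧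
    -- the operators `Φ` and `Ψ` are well defined, with values in `L²(0, T)`
    (∀ g ∈ KelvinVoigtBeam.G1 T Cg, ∃! y : KelvinVoigtBeam.L2 0 T,
      KelvinVoigtBeam.IsDeflection ρ μ r κ (KelvinVoigtBeam.Sobolev.D 0 g) y) ∧
    (∀ g ∈ KelvinVoigtBeam.G3 T Cg', ∃! y : KelvinVoigtBeam.L2 0 T,
      KelvinVoigtBeam.IsMoment ρ μ r κ (KelvinVoigtBeam.Sobolev.D 0 g) y) ∧
    -- unique minimizers
    (∃! g : KelvinVoigtBeam.Sobolev 0 T 1, g ∈ KelvinVoigtBeam.G1 T Cg ∧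
      IsMinOn (KelvinVoigtBeam.J1 ρ μ r κ ν α) (KelvinVoigtBeam.G1 T Cg) g) ∧
    (∃! g : KelvinVoigtBeam.Sobolev 0 T 3, g ∈ KelvinVoigtBeam.G3 T Cg' ∧
      IsMinOn (KelvinVoigtBeam.J2 ρ μ r κ ω α) (KelvinVoigtBeam.G3 T Cg') g) := by
  open KelvinVoigtBeam in
  obtain ⟨rb, hrb⟩ := exists_Linfty_ae_eq (Sobolev.D 0 r) hr
  obtain ⟨κb, hκb⟩ := exists_Linfty_ae_eq (Sobolev.D 0 κ) hκ
  have hρ' : ∀ᵐ x ∂(vol 0 ℓ), ρ₀ ≤ ρ x := hρ.mono fun x hx => hx.1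
  have hμ' : ∀ᵐ x ∂(vol 0 ℓ), 0 ≤ μ x := hμ.mono fun x hx => hμ₀.trans hx.1
  have hr' : ∀ᵐ x ∂(vol 0 ℓ), 0 ≤ rb x := by
    filter_upwards [hrb, hr] with x h1 h2
    rw [h1]
    exact hr₀.le.trans h2.1
  -- The coercivity estimate needs a positive upper bound; the maximum with 1 provides it without
  -- deducing r₁ > 0 from the a.e. bounds.
  have hr'' : ∀ᵐ x ∂(vol 0 ℓ), rb x ≤ max r₁ 1 := by
    filter_upwards [hrb, hr] with x h1 h2
    rw [h1]
    exact h2.2.trans (le_max_left _ _)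
  have hκ' : ∀ᵐ x ∂(vol 0 ℓ), κ₀ ≤ κb x := by
    filter_upwards [hκb, hκ] with x h1 h2
    rw [h1]
    exact h2.1
  obtain ⟨S, hS⟩ := exists_beam_solution_operator (ρ := ρ) (μ := μ) hℓ hT hρ₀ hρ' hμ' hr'
    (lt_max_of_lt_right one_pos) hr'' hκ₀ hκ'
  have hinj := beam_injective (ℓ := ℓ) hT (hρ'.mono fun x hx => hρ₀.le.trans hx) hμ' hr' hκ₀ hκ'
  have hdefl := fun h => isDeflection_iff hℓ hT hinj hrb hκb (hS h)
  have hmom := fun h => isMoment_iff hℓ hT hinj hr' hκ₀ hκ' hrb hκb (hS h)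
  refine ⟨fun g hg => ?_, fun g hg => ?_, fun g hg => ?_, ?_, ?_⟩
  · rw [show Sobolev.D 0 g = volterra T ℝ (Sobolev.D 1 g) from Sobolev.D_eq_volterra hT g 0 hg]
    refine ⟨_, ⟨_, _, isWeakSolution_of_evolutionOp_eq hℓ hT hrb hκb (hS _)⟩, ?_⟩
    rintro u ⟨ut, utt, hw⟩
    obtain ⟨z, hz, hu, -⟩ := hw.evolutionOp_eq hℓ hT hrb hκb
    have h1 : (utt, z) = S (Sobolev.D 1 g) :=
      sub_eq_zero.1 (hinj _ (by rw [map_sub, hz, hS, sub_self]))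
    rw [hu]
    exact congrArg (fun p => (V.ofSecondDeriv hℓ).compLpL 2 (vol 0 T)
      (volterra T (L2 0 ℓ) (Prod.snd p))) h1
  · rw [show Sobolev.D 0 g = volterra T ℝ (Sobolev.D 1 g) from Sobolev.D_eq_volterra hT g 0 hg.1]
    exact ⟨_, (hdefl _ _).2 rfl, fun y hy => (hdefl _ _).1 hy⟩
  · rw [show Sobolev.D 0 g = volterra T ℝ (Sobolev.D 1 g) from Sobolev.D_eq_volterra hT g 0 hg.1]
    exact ⟨_, (hmom _ _).2 rfl, fun y hy => (hmom _ _).1 hy⟩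
  · refine existsUnique_isMinOn_of_param (fun h => ⟨ofDeriv T h, ofDeriv_mem hT h⟩)
      (Sobolev.D 1) (fun h hh => ⟨hasValueAt_volterra_zero h, hh⟩) (fun g hg => ?_)
      (fun g hg => Subtype.ext (ofDeriv_D_one hT hg.1)) (fun h _ => ?_)
      (existsUnique_isMinOn_tikhonov_of_norm_le
        (((innerSL ℝ (ofCont hℓ (endFun ℓ))).compLpL 2 (vol 0 T)).comp
          ((volterra T (L2 0 ℓ)).comp ((ContinuousLinearMap.snd ℝ _ _).comp S)))
        ν hα (ofDeriv T) hCg.le)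
    · change ‖ofDeriv T (Sobolev.D 1 g)‖ ≤ Cg
      rw [ofDeriv_D_one hT hg.1]
      exact hg.2
    · change 1 / 2 * ‖Phi ρ μ r κ (volterra T ℝ h) - ν‖ ^ 2 + α / 2 * ‖h‖ ^ 2 = _
      rw [Phi_eq (hdefl h)]
      rfl
  · refine existsUnique_isMinOn_of_param (fun h => ⟨ofThirdDeriv T h, ofThirdDeriv_mem hT h⟩)
      (Sobolev.D 3) (fun h hh => ⟨hasValueAt_volterra_zero _, hasValueAt_volterra_zero _,
        hasValueAt_volterra_zero h, hh⟩) (fun g hg => ?_)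
      (fun g hg => Subtype.ext (ofThirdDeriv_D_three hT hg.1 hg.2.1 hg.2.2.1))
      (fun h _ => ?_)
      (existsUnique_isMinOn_tikhonov_of_norm_le
        -- With h = g''', two integrations give g'; a third gives g, while S takes g' to (u_tt,
        -- u_xxt). These are the arguments of `leftMoment`.
        ((leftMoment T hℓ ρ μ).comp (((volterra T ℝ).prod S).comp
          ((volterra T ℝ).comp (volterra T ℝ))))
        ω hα (ofThirdDeriv T) hCg'.le)
    · change ‖ofThirdDeriv T (Sobolev.D 3 g)‖ ≤ Cg'
      rw [ofThirdDeriv_D_three hT hg.1 hg.2.1 hg.2.2.1]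
      exact hg.2.2.2
    · change 1 / 2 * ‖Psi ρ μ r κ (volterra T ℝ (volterra T ℝ (volterra T ℝ h))) - ω‖ ^ 2
        + α / 2 * ‖h‖ ^ 2 = _
      rw [Psi_eq (hmom (volterra T ℝ (volterra T ℝ h)))]
      rfl
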